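/- Conventions. A $k$-graph $\Lambda$ is a small category with a degree functor $d:\Lambda\to\mathbb N^k$ satisfying the factorisation property; $\Lambda^p=d^{-1}(p)$, $\Lambda^0$ is the set of vertices, $r,s$ are range and source; $\Lambda$ is finite if every $\Lambda^p$ is finite. A partial isomorphism of $\Lambda$ is a degree-preserving bijection $g:v\Lambda\to w\Lambda$ $(v,w\in\Lambda^0)$ with $g(\lambda e)\in g(\lambda)\Lambda$ for all $\lambda\in v\Lambda$ and all edges $e\in s(\lambda)\Lambda$ (edges are the paths of degree $e_1,\dots,e_k$). A self-similar groupoid action $(G,\Lambda)$ is a groupoid $G$ with unit space $\Lambda^0$ and an injective homomorphism from $G$ to the groupoid of partial isomorphisms of $\Lambda$, identity on $\Lambda^0$, such that for every $g\in G$ and every edge $e\in\mathrm{dom}(g)\Lambda$ there is $h\in G$ with $g\cdot(e\lambda)=(g\cdot e)(h\cdot\lambda)$ for all $\lambda\in s(e)\Lambda$. Then for every $\lambda\in\mathrm{dom}(g)\Lambda$ there is a unique $g|_\lambda\in G$ with domain $s(\lambda)$, codomain $s(g\cdot\lambda)$ and $g\cdot(\lambda\mu)=(g\cdot\lambda)(g|_\lambda\cdot\mu)$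 for all $\mu\in s(\lambda)\Lambda$. $C^*(G)$ is the full $C^*$-algebra of $G$, with canonical unitary representation $g\mapsto i_g$. $X(\Lambda_p)$ is the graph bimodule of the directed graph $\Lambda_p=(\Lambda^0,\Lambda^p,r,s)$: the functions $\Lambda^p\to\mathbb C$ with $(x\cdot f)(\lambda)=x(\lambda)f(s(\lambda))$ and $\langle x,y\rangle(v)=\sum_{s(\lambda)=v}\overline{x(\lambda)}y(\lambda)$ for $f\in C(\Lambda^0)$. $M_p:=X(\Lambda_p)\otimes_{C(\Lambda^0)}C^*(G)=\bigoplus_{\lambda\in\Lambda^p}i_{s(\lambda)}C^*(G)$, a right Hilbert $C^*(G)$-module. Proposition. Let $\Lambda$ be a finite $k$-graph and $(G,\Lambda)$ a self-similar groupoid action. (1) For each nonzero $p\in\mathbb N^k$ the groupoid $G$ acts by partial isomorphisms on the finite-path space of the directed graph $\Lambda_p$, extending its action on $\Lambda^p$, and this action is self-similar with the same restrictions: $g\cdot(\lambda\mu)=(g\cdot\lambda)(g|_\lambda\cdot\mu)$ for $\lambda\in\mathrm{dom}(g)\Lambda^p$ and paths $\mu$ of $\Lambda_p$ with $r(\mu)=s(\lambda)$.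 (2) There is exactly one product system of right Hilbert $C^*(G)$-bimodules over $\mathbb N^k$ with fibres $M_p$ $(p\in\mathbb N^k)$ for which: the left actions satisfy $i_g\cdot(\delta_\lambda\otimes a)=\delta_{g\cdot\lambda}\otimes i_{g|_\lambda}a$ if $r(\lambda)=\mathrm{dom}(g)$ and $=0$ otherwise; $M_0$ is identified with the standard bimodule $C^*(G)$ through $i_g\mapsto\delta_{\mathrm{cod}(g)}\otimes i_g$; and for nonzero $p,q\in\mathbb N^k$ the multiplication satisfies $$(\delta_\lambda\otimes i_g)(\delta_\mu\otimes i_h)=\begin{cases}\delta_{\lambda(g\cdot\mu)}\otimes i_{(g|_\mu)h}&\text{if }r(\mu)=\mathrm{dom}(g),\\0&\text{otherwise,}\end{cases}$$ for $\lambda\in\Lambda^p$, $\mu\in\Lambda^q$ and $g,h\in G$ with $\mathrm{cod}(g)=s(\lambda)$, $\mathrm{cod}(h)=s(\mu)$. Here a product system has an associative bilinear multiplication $M_p\times M_q\to M_{p+q}$ which descends to an isomorphism of bimodules $M_p\otimes_{C^*(G)}M_q\to M_{p+q}$ for all $p,q$, and multiplication by elements of $M_0=C^*(G)$ is given by the left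 and right actions. (3) For this product system the multiplication formula holds for all $p,q\in\mathbb N^k$; each fibre is essential; $C^*(G)$ acts on the left of each fibre by compact operators; and the system is compactly aligned, that is, for compact operators $S$ on $M_p$ and $T$ on $M_q$, the induced operators $S'$, $T'$ on $M_{p\vee q}$ (determined by $S'(xy)=S(x)y$ for $x\in M_p$, $y\in M_{(p\vee q)-p}$, and similarly for $T'$) exist and $S'T'$ is compact. -/

import Mathlib

noncomputable section

open CategoryTheory
open scoped ComplexOrder

namespace SSGA

universe u v w

/-! ### The full C*-algebra of a discrete groupoid -/

/-- The set of arrows of a groupoid `G` with unit space `V`. -/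
@[ext] structure Arr (V : Type u) [Groupoid.{v} V] : Type (max u v) where
  dom : V
  cod : V
  hom : dom ⟶ cod

/-- The `*`-algebra `ℂG` of finitely supported functions on the arrows of `G`, with the
convolution product and the involution determined by `a ↦ a⁻¹` on arrows. -/
def GroupoidAlgebra (V : Type u) [Groupoid.{v} V] : Type (max u v) := Arr V →₀ ℂ

namespace GroupoidAlgebra

variable {V : Type u} [Groupoid.{v} V]

instance : AddCommGroup (GroupoidAlgebra V) := inferInstanceAs (AddCommGroup (Arr V →₀ ℂ))
instance : Module ℂ (GroupoidAlgebra V) := inferInstanceAs (Module ℂ (Arr V →₀ ℂ))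

/-- The point mass at an arrow. -/
def pt (a : Arr V) : GroupoidAlgebra V := Finsupp.single a 1

/-- The arrow `a⁻¹`. -/
def inv (a : Arr V) : Arr V := ⟨a.cod, a.dom, Groupoid.inv a.hom⟩

@[simp] lemma inv_inv (a : Arr V) : inv (inv a) = a := by
  cases a; simp [inv]

open Classical in
/-- The product of point masses: `δ_a δ_b = δ_{ab}` if `dom a = cod b`, and `0` otherwise. -/
def ptMul (a b : Arr V) : GroupoidAlgebra V :=
  if h : b.cod = a.dom then pt ⟨b.dom, a.cod, b.hom ≫ eqToHom h ≫ a.hom⟩ else 0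

lemma ext_lin {W : Type*} [AddCommMonoid W] [Module ℂ W] {f g : GroupoidAlgebra V →ₗ[ℂ] W}
    (h : ∀ a, f (pt a) = g (pt a)) : f = g :=
  Finsupp.lhom_ext' fun a => LinearMap.ext_ring (h a)

/-- The linear extension of a function on arrows. -/
def extend {W : Type*} [AddCommMonoid W] [Module ℂ W] (F : Arr V → W) :
    GroupoidAlgebra V →ₗ[ℂ] W := Finsupp.linearCombination ℂ F

@[simp] lemma extend_pt {W : Type*} [AddCommMonoid W] [Module ℂ W] (F : Arr V → W) (a : Arr V) :
    extend F (pt a) = F a := by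
  rw [extend, pt]
  erw [Finsupp.linearCombination_single]
  rw [one_smul]

/-- The convolution product as a bilinear map. -/
def mulLin : GroupoidAlgebra V →ₗ[ℂ] GroupoidAlgebra V →ₗ[ℂ] GroupoidAlgebra V :=
  extend fun a => extend fun b => ptMul a b

instance : Mul (GroupoidAlgebra V) := ⟨fun f g => mulLin f g⟩

lemma mul_def (f g : GroupoidAlgebra V) : f * g = mulLin f g := rfl

@[simp] lemma pt_mul_pt (a b : Arr V) : pt a * pt b = ptMul a b := by
  simp [mul_def, mulLin]

lemma ptMul_of_eq {x y z : V} (g : y ⟶ z) (h : x ⟶ y) :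
    ptMul ⟨y, z, g⟩ ⟨x, y, h⟩ = pt ⟨x, z, h ≫ g⟩ := by
  simp [ptMul]

lemma ptMul_of_ne {a b : Arr V} (h : b.cod ≠ a.dom) : ptMul a b = 0 := by
  simp [ptMul, h]

lemma pt_assoc (a b c : Arr V) : ptMul a b * pt c = pt a * ptMul b c := by
  by_cases h₁ : b.cod = a.dom
  · by_cases h₂ : c.cod = b.dom
    · obtain ⟨_, _, a⟩ := a
      obtain ⟨_, _, b⟩ := b
      obtain ⟨_, _, c⟩ := c
      dsimp only at h₁ h₂
      subst h₁ h₂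
      simp only [ptMul_of_eq, pt_mul_pt, Category.assoc]
    · have e : ptMul a b * pt c = 0 := by
        rw [ptMul, dif_pos h₁, pt_mul_pt]
        exact ptMul_of_ne h₂
      rw [e, ptMul_of_ne h₂]
      simp [mul_def]
  · rw [ptMul_of_ne h₁]
    by_cases h₂ : c.cod = b.dom
    · rw [ptMul, dif_pos h₂, pt_mul_pt, ptMul_of_ne (by exact h₁)]
      simp [mul_def]
    · rw [ptMul_of_ne h₂]
      simp [mul_def]

lemma induction_pt {P : GroupoidAlgebra V → Prop} (hadd : ∀ f g, P f → P g → P (f + g))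
    (hsmul : ∀ (z : ℂ) f, P f → P (z • f)) (hpt : ∀ a, P (pt a)) (hzero : P 0)
    (f : GroupoidAlgebra V) : P f := by
  refine Finsupp.induction_linear (motive := P) f hzero (fun f g => hadd f g) fun a z => ?_
  have h : (Finsupp.single a z : Arr V →₀ ℂ) = z • (Finsupp.single a 1 : Arr V →₀ ℂ) := by simp
  rw [h]
  exact hsmul z _ (hpt a)

lemma smul_mul' (z : ℂ) (f g : GroupoidAlgebra V) : (z • f) * g = z • (f * g) := by
  simp [mul_def]

lemma mul_smul' (z : ℂ) (f g : GroupoidAlgebra V) : f * (z • g) = z • (f * g) := by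
  simp [mul_def]

instance : NonUnitalRing (GroupoidAlgebra V) where
  left_distrib f g h := by simp [mul_def]
  right_distrib f g h := by simp [mul_def]
  zero_mul f := by simp [mul_def]
  mul_zero f := by simp [mul_def]
  mul_assoc f g h := by
    have hl (f f' g : GroupoidAlgebra V) : f * (f' + g) = f * f' + f * g := by simp [mul_def]
    have hr (f f' g : GroupoidAlgebra V) : (f + f') * g = f * g + f' * g := by simp [mul_def]
    have h0 (g : GroupoidAlgebra V) : 0 * g = 0 := by simp [mul_def]
    have h0' (g : GroupoidAlgebra V) : g * 0 = 0 := by simp [mul_def]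
    induction f using induction_pt with
    | hadd f f' hf hf' => rw [hr, hr, hr, hf, hf']
    | hsmul z f hf => rw [smul_mul', smul_mul', smul_mul', hf]
    | hzero => simp only [h0]
    | hpt a =>
      induction g using induction_pt with
      | hadd f f' hf hf' => rw [hl, hr, hr, hl, hf, hf']
      | hsmul z f hf => rw [smul_mul', mul_smul', mul_smul', smul_mul', hf]
      | hzero => simp only [h0, h0']
      | hpt b =>
        induction h using induction_pt with
        | hadd f f' hf hf' => rw [hl, hl, hl, hf, hf']
        | hsmul z f hf => rw [mul_smul', mul_smul', mul_smul', hf]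
        | hzero => simp only [h0']
        | hpt c => rw [pt_mul_pt, pt_mul_pt, pt_assoc]

/-- The unit arrow at `v`. -/
def unitArr (v : V) : Arr V := ⟨v, v, 𝟙 v⟩

section Unit

variable [Fintype V]

instance : One (GroupoidAlgebra V) := ⟨∑ v : V, pt (unitArr v)⟩

lemma one_def : (1 : GroupoidAlgebra V) = ∑ v : V, pt (unitArr v) := rfl

lemma one_mul_pt (a : Arr V) : 1 * pt a = pt a := by
  rw [one_def, Finset.sum_mul, Finset.sum_eq_single a.cod]
  · rw [pt_mul_pt]
    obtain ⟨x, y, a⟩ := a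
    exact (ptMul_of_eq _ _).trans (by simp)
  · intro v _ hv
    rw [pt_mul_pt]
    exact ptMul_of_ne (fun h => hv h.symm)
  · simp

lemma pt_mul_one (a : Arr V) : pt a * 1 = pt a := by
  rw [one_def, Finset.mul_sum, Finset.sum_eq_single a.dom]
  · rw [pt_mul_pt]
    obtain ⟨x, y, a⟩ := a
    exact (ptMul_of_eq _ _).trans (by simp)
  · intro v _ hv
    rw [pt_mul_pt]
    exact ptMul_of_ne hv
  · simp

instance : Ring (GroupoidAlgebra V) where
  __ := (inferInstance : NonUnitalRing (GroupoidAlgebra V))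
  one_mul f := by
    induction f using induction_pt with
    | hadd f f' hf hf' => rw [mul_add, hf, hf']
    | hsmul z f hf => rw [mul_smul', hf]
    | hzero => rw [mul_zero]
    | hpt a => exact one_mul_pt a
  mul_one f := by
    induction f using induction_pt with
    | hadd f f' hf hf' => rw [add_mul, hf, hf']
    | hsmul z f hf => rw [smul_mul', hf]
    | hzero => rw [zero_mul]
    | hpt a => exact pt_mul_one a
  zsmul := fun n f => n • f
  zsmul_zero' := SubNegMonoid.zsmul_zero'
  zsmul_succ' := SubNegMonoid.zsmul_succ'
  zsmul_neg' := SubNegMonoid.zsmul_neg'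
  neg_add_cancel := neg_add_cancel
  sub_eq_add_neg := sub_eq_add_neg

instance : Algebra ℂ (GroupoidAlgebra V) := Algebra.ofModule smul_mul' mul_smul'

end Unit

/-- The involution `f ↦ f*`, with `f*(a) = conj (f (a⁻¹))`. -/
instance : Star (GroupoidAlgebra V) :=
  ⟨fun f => Finsupp.equivMapDomain ⟨inv, inv, inv_inv, inv_inv⟩
    (Finsupp.mapRange (starRingEnd ℂ) (map_zero _) f)⟩

/-- The value of `f ∈ ℂG` at an arrow. -/
def coeff (f : GroupoidAlgebra V) (a : Arr V) : ℂ := DFunLike.coe (F := Arr V →₀ ℂ) f a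

lemma star_apply (f : GroupoidAlgebra V) (a : Arr V) :
    coeff (star f) a = starRingEnd ℂ (coeff f (inv a)) := rfl

lemma pt_apply_self (a : Arr V) : coeff (pt a) a = 1 := Finsupp.single_eq_same

lemma pt_apply_ne {a b : Arr V} (h : a ≠ b) : coeff (pt a) b = 0 :=
  Finsupp.single_eq_of_ne' h

lemma star_add' (f g : GroupoidAlgebra V) : star (f + g) = star f + star g :=
  Finsupp.ext fun _ => map_add (starRingEnd ℂ) _ _

lemma star_smul' (z : ℂ) (f : GroupoidAlgebra V) : star (z • f) = star z • star f :=
  Finsupp.ext fun _ => map_mul (starRingEnd ℂ) _ _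

lemma star_zero' : star (0 : GroupoidAlgebra V) = 0 :=
  Finsupp.ext fun _ => map_zero (starRingEnd ℂ)

lemma star_pt (a : Arr V) : star (pt a) = pt (inv a) := by
  refine Finsupp.ext fun b => ?_
  change coeff (star (pt a)) b = coeff (pt (inv a)) b
  rw [star_apply]
  by_cases h : a = inv b
  · subst h
    rw [inv_inv, pt_apply_self, pt_apply_self, map_one]
  · have h' : inv a ≠ b := fun e => h (by rw [← e, inv_inv])
    rw [pt_apply_ne h, pt_apply_ne h', map_zero]

lemma star_ptMul (a b : Arr V) : star (ptMul a b) = ptMul (inv b) (inv a) := by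
  by_cases h : b.cod = a.dom
  · obtain ⟨_, _, a⟩ := a
    obtain ⟨_, _, b⟩ := b
    dsimp only at h
    subst h
    simp [ptMul_of_eq, star_pt, inv]
  · rw [ptMul_of_ne h, star_zero', ptMul_of_ne]
    exact fun e => h e.symm

instance : StarRing (GroupoidAlgebra V) where
  star_involutive f := Finsupp.ext fun a => by
    change coeff (star (star f)) a = coeff f a
    rw [star_apply, star_apply, inv_inv]
    exact Complex.conj_conj _
  star_add := star_add'
  star_mul f g := by
    induction f using induction_pt with
    | hadd f f' hf hf' => rw [add_mul, star_add', hf, hf', star_add', mul_add]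
    | hsmul z f hf => rw [smul_mul', star_smul', star_smul', hf, mul_smul']
    | hzero => rw [zero_mul, star_zero', mul_zero]
    | hpt a =>
      induction g using induction_pt with
      | hadd f f' hf hf' => rw [mul_add, star_add', hf, hf', star_add', add_mul]
      | hsmul z f hf => rw [mul_smul', star_smul', star_smul', hf, smul_mul']
      | hzero => rw [mul_zero, star_zero', zero_mul]
      | hpt b => rw [pt_mul_pt, star_ptMul, star_pt, star_pt, pt_mul_pt]

instance : StarModule ℂ (GroupoidAlgebra V) := ⟨star_smul'⟩

/-- A C*-seminorm on `ℂG`: a submultiplicative seminorm with `‖f* f‖ = ‖f‖²`. -/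
structure IsCStarSeminorm (p : Seminorm ℂ (GroupoidAlgebra V)) : Prop where
  mul_le : ∀ f g, p (f * g) ≤ p f * p g
  star_mul_self : ∀ f, p (star f * f) = p f * p f

variable (V) in
/-- The type of all C*-seminorms on `ℂG`. -/
abbrev CStarSeminorm := {p : Seminorm ℂ (GroupoidAlgebra V) // IsCStarSeminorm p}

instance : Nonempty (CStarSeminorm V) := ⟨⟨0, ⟨by simp, by simp⟩⟩⟩

namespace CStarSeminorm

lemma pt_le_one (p : CStarSeminorm V) (a : Arr V) : p.1 (pt a) ≤ 1 := by
  have h1 : p.1 (pt (unitArr a.dom)) = p.1 (pt (unitArr a.dom)) * p.1 (pt (unitArr a.dom)) := by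
    have := p.2.star_mul_self (pt (unitArr a.dom))
    rwa [star_pt, pt_mul_pt, show inv (unitArr a.dom) = unitArr a.dom by simp [inv, unitArr],
      unitArr, ptMul_of_eq, Category.comp_id] at this
  have h2 : p.1 (pt (unitArr a.dom)) = p.1 (pt a) * p.1 (pt a) := by
    have := p.2.star_mul_self (pt a)
    obtain ⟨x, y, a⟩ := a
    rw [star_pt, pt_mul_pt, inv, ptMul_of_eq] at this
    simpa [unitArr] using this
  have h3 : p.1 (pt (unitArr a.dom)) ≤ 1 := by
    by_contra! h
    nlinarith
  have h4 : 0 ≤ p.1 (pt a) := apply_nonneg _ _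
  nlinarith

lemma bddAbove (f : GroupoidAlgebra V) : BddAbove (Set.range fun p : CStarSeminorm V => p.1 f) := by
  induction f using induction_pt with
  | hadd f g hf hg =>
    obtain ⟨C, hC⟩ := hf
    obtain ⟨D, hD⟩ := hg
    refine ⟨C + D, ?_⟩
    rintro _ ⟨p, rfl⟩
    exact (map_add_le_add p.1 f g).trans (add_le_add (hC ⟨p, rfl⟩) (hD ⟨p, rfl⟩))
  | hsmul z f hf =>
    obtain ⟨C, hC⟩ := hf
    refine ⟨‖z‖ * C, ?_⟩
    rintro _ ⟨p, rfl⟩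
    change p.1 (z • f) ≤ _
    rw [map_smul_eq_mul]
    exact mul_le_mul_of_nonneg_left (hC ⟨p, rfl⟩) (norm_nonneg z)
  | hpt a => exact ⟨1, by rintro _ ⟨p, rfl⟩; exact pt_le_one p a⟩
  | hzero => exact ⟨0, by rintro _ ⟨p, rfl⟩; exact (map_zero p.1).le⟩

end CStarSeminorm

/-- The largest C*-seminorm on `ℂG`, that is, the norm of the full C*-algebra of `G`. -/
def maxNorm (f : GroupoidAlgebra V) : ℝ := ⨆ p : CStarSeminorm V, p.1 f

lemma le_maxNorm (p : CStarSeminorm V) (f : GroupoidAlgebra V) : p.1 f ≤ maxNorm f :=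
  le_ciSup (CStarSeminorm.bddAbove f) p

lemma maxNorm_nonneg (f : GroupoidAlgebra V) : 0 ≤ maxNorm f :=
  Real.iSup_nonneg fun p => apply_nonneg p.1 f

lemma maxNorm_le {f : GroupoidAlgebra V} {C : ℝ} (h : ∀ p : CStarSeminorm V, p.1 f ≤ C) :
    maxNorm f ≤ C := ciSup_le h

lemma maxNorm_mul_le (f g : GroupoidAlgebra V) : maxNorm (f * g) ≤ maxNorm f * maxNorm g :=
  maxNorm_le fun p => (p.2.mul_le f g).trans <|
    mul_le_mul (le_maxNorm p f) (le_maxNorm p g) (apply_nonneg _ _) (maxNorm_nonneg f)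

lemma maxNorm_star_mul_self (f : GroupoidAlgebra V) :
    maxNorm (star f * f) = maxNorm f * maxNorm f := by
  refine le_antisymm (maxNorm_le fun p => ?_) ?_
  · rw [p.2.star_mul_self]
    exact mul_self_le_mul_self (apply_nonneg _ _) (le_maxNorm p f)
  · have h : maxNorm f ≤ √(maxNorm (star f * f)) := maxNorm_le fun p => by
      refine Real.le_sqrt_of_sq_le ?_
      rw [sq, ← p.2.star_mul_self]
      exact le_maxNorm p _
    calc maxNorm f * maxNorm f ≤ √(maxNorm (star f * f)) * √(maxNorm (star f * f)) :=
          mul_self_le_mul_self (maxNorm_nonneg f) h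
      _ = maxNorm (star f * f) := Real.mul_self_sqrt (maxNorm_nonneg _)

lemma maxNorm_star (f : GroupoidAlgebra V) : maxNorm (star f) = maxNorm f := by
  have key (g : GroupoidAlgebra V) : maxNorm g ≤ maxNorm (star g) := by
    rcases (maxNorm_nonneg g).eq_or_lt with h | h
    · rw [← h]
      exact maxNorm_nonneg _
    · refine le_of_mul_le_mul_right ?_ h
      rw [← maxNorm_star_mul_self]
      exact maxNorm_mul_le _ _
  refine le_antisymm ?_ (key f)
  simpa using key (star f)

lemma maxNorm_smul (z : ℂ) (f : GroupoidAlgebra V) : maxNorm (z • f) = ‖z‖ * maxNorm f := by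
  simp only [maxNorm, map_smul_eq_mul, Real.mul_iSup_of_nonneg (norm_nonneg z)]

/-- `maxNorm` as a seminorm of additive groups. -/
def maxSeminorm : AddGroupSeminorm (GroupoidAlgebra V) where
  toFun := maxNorm
  map_zero' := by simp [maxNorm]
  add_le' f g := maxNorm_le fun p => (map_add_le_add p.1 f g).trans
    (add_le_add (le_maxNorm p f) (le_maxNorm p g))
  neg' f := by simp [maxNorm]

section Norm

variable [Fintype V]

instance : SeminormedRing (GroupoidAlgebra V) where
  __ := (inferInstance : Ring (GroupoidAlgebra V))
  __ := maxSeminorm.toSeminormedAddCommGroup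
  norm_mul_le := maxNorm_mul_le

lemma norm_def (f : GroupoidAlgebra V) : ‖f‖ = maxNorm f := rfl

instance : NormedSpace ℂ (GroupoidAlgebra V) where
  norm_smul_le z f := (maxNorm_smul z f).le

lemma norm_star' (f : GroupoidAlgebra V) : ‖star f‖ = ‖f‖ := maxNorm_star f

end Norm

end GroupoidAlgebra

open UniformSpace

/-- The full C*-algebra `C*(G)` of the groupoid `G`: the (separated) completion of `ℂG` in its
largest C*-seminorm. -/
def GroupoidCStar (V : Type u) [Groupoid.{v} V] [Fintype V] : Type (max u v) :=
  Completion (GroupoidAlgebra V)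

namespace GroupoidCStar

variable {V : Type u} [Groupoid.{v} V] [Fintype V]

instance : NormedRing (GroupoidCStar V) := inferInstanceAs (NormedRing (Completion _))
instance : CompleteSpace (GroupoidCStar V) := inferInstanceAs (CompleteSpace (Completion _))
instance : NormedSpace ℂ (GroupoidCStar V) :=
  inferInstanceAs (NormedSpace ℂ (Completion (GroupoidAlgebra V)))

/-- The canonical map `ℂG → C*(G)`. -/
def of (f : GroupoidAlgebra V) : GroupoidCStar V := (f : Completion (GroupoidAlgebra V))

lemma of_add (f g : GroupoidAlgebra V) : of (f + g) = of f + of g := Completion.coe_add f g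
lemma of_mul (f g : GroupoidAlgebra V) : of (f * g) = of f * of g := Completion.coe_mul f g
lemma of_smul (z : ℂ) (f : GroupoidAlgebra V) : of (z • f) = z • of f := Completion.coe_smul z f
lemma of_zero : of (0 : GroupoidAlgebra V) = 0 := rfl
lemma of_one : of (1 : GroupoidAlgebra V) = 1 := rfl
lemma norm_of (f : GroupoidAlgebra V) : ‖of f‖ = ‖f‖ := Completion.norm_coe f
lemma continuous_of : Continuous (of : GroupoidAlgebra V → GroupoidCStar V) :=
  Completion.continuous_coe _
lemma denseRange_of : DenseRange (of : GroupoidAlgebra V → GroupoidCStar V) :=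
  Completion.denseRange_coe

lemma induction {P : GroupoidCStar V → Prop} (hc : IsClosed {a | P a}) (h : ∀ f, P (of f))
    (a : GroupoidCStar V) : P a := Completion.induction_on (α := GroupoidAlgebra V) a hc h

lemma induction₂ {P : GroupoidCStar V → GroupoidCStar V → Prop}
    (hc : IsClosed {a : GroupoidCStar V × GroupoidCStar V | P a.1 a.2})
    (h : ∀ f g, P (of f) (of g)) (a b : GroupoidCStar V) : P a b :=
  Completion.induction_on₂ (α := GroupoidAlgebra V) (β := GroupoidAlgebra V) a b hc h

lemma smul_mul' (z : ℂ) (a b : GroupoidCStar V) : (z • a) * b = z • (a * b) := by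
  refine induction₂ (P := fun a b => (z • a) * b = z • (a * b)) ?_ (fun f g => ?_) a b
  · exact isClosed_eq ((continuous_fst.const_smul z).mul continuous_snd)
      ((continuous_fst.mul continuous_snd).const_smul z)
  · rw [← of_smul, ← of_mul, ← of_mul, ← of_smul, GroupoidAlgebra.smul_mul']

lemma mul_smul' (z : ℂ) (a b : GroupoidCStar V) : a * (z • b) = z • (a * b) := by
  refine induction₂ (P := fun a b => a * (z • b) = z • (a * b)) ?_ (fun f g => ?_) a b
  · exact isClosed_eq (continuous_fst.mul (continuous_snd.const_smul z))
      ((continuous_fst.mul continuous_snd).const_smul z)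
  · rw [← of_smul, ← of_mul, ← of_mul, ← of_smul, GroupoidAlgebra.mul_smul']

instance : Algebra ℂ (GroupoidCStar V) := Algebra.ofModule smul_mul' mul_smul'

instance : NormedAlgebra ℂ (GroupoidCStar V) where
  norm_smul_le := norm_smul_le

lemma uniformContinuous_star :
    UniformContinuous (star : GroupoidAlgebra V → GroupoidAlgebra V) := by
  refine (LipschitzWith.of_dist_le_mul (K := 1) fun f g => ?_).uniformContinuous
  rw [dist_eq_norm, dist_eq_norm, ← star_sub, GroupoidAlgebra.norm_star']
  simp

instance : Star (GroupoidCStar V) :=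
  ⟨Completion.map (star : GroupoidAlgebra V → GroupoidAlgebra V)⟩

lemma star_of (f : GroupoidAlgebra V) : star (of f) = of (star f) :=
  Completion.map_coe uniformContinuous_star f

lemma continuous_star' : Continuous (star : GroupoidCStar V → GroupoidCStar V) :=
  Completion.continuous_map

instance : StarRing (GroupoidCStar V) where
  star_involutive a := by
    induction a using induction with
    | hc => exact isClosed_eq (continuous_star'.comp continuous_star') continuous_id
    | h f => rw [star_of, star_of, star_star]
  star_add a b := by
    refine induction₂ (P := fun a b => star (a + b) = star a + star b) ?_ (fun f g => ?_) a b
    · exact isClosed_eq (continuous_star'.comp (continuous_fst.add continuous_snd))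
        ((continuous_star'.comp continuous_fst).add (continuous_star'.comp continuous_snd))
    · rw [← of_add, star_of, star_of, star_of, star_add, of_add]
  star_mul a b := by
    refine induction₂ (P := fun a b => star (a * b) = star b * star a) ?_ (fun f g => ?_) a b
    · exact isClosed_eq (continuous_star'.comp (continuous_fst.mul continuous_snd))
        ((continuous_star'.comp continuous_snd).mul (continuous_star'.comp continuous_fst))
    · rw [← of_mul, star_of, star_of, star_of, star_mul, of_mul]

instance : CStarRing (GroupoidCStar V) where
  norm_mul_self_le a := by
    induction a using induction with
    | hc => exact isClosed_le (by fun_prop) (continuous_star'.mul continuous_id).norm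
    | h f =>
      rw [star_of, ← of_mul, norm_of, norm_of]
      exact (GroupoidAlgebra.maxNorm_star_mul_self f).ge

instance : StarModule ℂ (GroupoidCStar V) where
  star_smul z a := by
    induction a using induction with
    | hc =>
      exact isClosed_eq (continuous_star'.comp (continuous_const_smul z))
        (continuous_star'.const_smul (star z))
    | h f => rw [← of_smul, star_of, star_of, star_smul, of_smul]

instance : CStarAlgebra (GroupoidCStar V) where

/-- `C*(G)` carries its usual order, given by self-adjointness and the spectrum. -/
instance : PartialOrder (GroupoidCStar V) := CStarAlgebra.spectralOrder _
instance : StarOrderedRing (GroupoidCStar V) := CStarAlgebra.spectralOrderedRing _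

/-- The canonical unitary representation `g ↦ i_g` of `G` in `C*(G)`. -/
def i {x y : V} (g : x ⟶ y) : GroupoidCStar V := of (GroupoidAlgebra.pt ⟨x, y, g⟩)

lemma i_mul_i {x y z : V} (h : x ⟶ y) (g : y ⟶ z) : i g * i h = i (h ≫ g) := by
  rw [i, i, ← of_mul, GroupoidAlgebra.pt_mul_pt, GroupoidAlgebra.ptMul_of_eq, i]

lemma i_mul_i_of_ne {x y x' y' : V} (g : x ⟶ y) (h : x' ⟶ y') (hne : y' ≠ x) : i g * i h = 0 := by
  rw [i, i, ← of_mul, GroupoidAlgebra.pt_mul_pt, GroupoidAlgebra.ptMul_of_ne hne, of_zero]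

lemma star_i {x y : V} (g : x ⟶ y) : star (i g) = i (Groupoid.inv g) := by
  rw [i, star_of, GroupoidAlgebra.star_pt]
  rfl

lemma sum_i_id : ∑ v : V, i (𝟙 v) = 1 := by
  have h : (⟨⟨of, of_zero⟩, of_add⟩ : GroupoidAlgebra V →+ GroupoidCStar V) 1 = 1 := of_one
  rw [GroupoidAlgebra.one_def, map_sum] at h
  exact h

end GroupoidCStar

end SSGA

/-! ### Right Hilbert modules and bimodules -/

namespace SSGA

open MulOpposite

/-- A right inner-product module over the C*-algebra `A`, with inner product linear in the second
variable and `⟨x, y · a⟩ = ⟨x, y⟩ a`. The right action of `a` on `x` is written `op a • x`.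
(Mathlib's `CStarModule` has the opposite convention `⟨x, a • y⟩ = a ⟨x, y⟩`.) -/
class InnerModule (A E : Type*) [CStarAlgebra A] [PartialOrder A] [StarOrderedRing A]
    [AddCommGroup E] [Module ℂ E] [Module Aᵐᵒᵖ E] where
  ip : E → E → A
  ip_add_right : ∀ x y z, ip x (y + z) = ip x y + ip x z
  ip_smul_right : ∀ (c : ℂ) x y, ip x (c • y) = c • ip x y
  ip_op_smul_right : ∀ (a : A) x y, ip x (op a • y) = ip x y * a
  star_ip : ∀ x y, star (ip x y) = ip y x
  ip_self_nonneg : ∀ x, 0 ≤ ip x x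
  eq_zero_of_ip_self : ∀ x, ip x x = 0 → x = 0

/-- A right Hilbert `A`-module: a right inner-product `A`-module that is complete in the norm
`‖x‖ = ‖⟨x, x⟩‖^{1/2}`. -/
class HilbertModule (A E : Type*) [CStarAlgebra A] [PartialOrder A] [StarOrderedRing A]
    [NormedAddCommGroup E] [NormedSpace ℂ E] [Module Aᵐᵒᵖ E]
    extends InnerModule A E, CompleteSpace E where
  norm_sq_eq : ∀ x, ‖x‖ ^ 2 = ‖ip x x‖

section InnerModule

open InnerModule

variable {A E : Type*} [CStarAlgebra A] [PartialOrder A] [StarOrderedRing A]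
  [AddCommGroup E] [Module ℂ E] [Module Aᵐᵒᵖ E] [InnerModule A E]

lemma ip_add_left (x y z : E) : ip (A := A) (x + y) z = ip x z + ip y z := by
  rw [← star_ip, ip_add_right, star_add, star_ip, star_ip]

lemma ip_smul_left (c : ℂ) (x y : E) : ip (A := A) (c • x) y = star c • ip x y := by
  rw [← star_ip, ip_smul_right, star_smul, star_ip]

lemma ip_op_smul_left (a : A) (x y : E) : ip (op a • x) y = star a * ip x y := by
  rw [← star_ip, ip_op_smul_right, star_mul, star_ip]

lemma ip_zero_right (x : E) : ip (A := A) x 0 = 0 := by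
  have := ip_add_right (A := A) x 0 0
  simpa using this

lemma ip_zero_left (x : E) : ip (A := A) 0 x = 0 := by
  rw [← star_ip, ip_zero_right, star_zero]

lemma ip_neg_right (x y : E) : ip (A := A) x (-y) = -ip x y := by
  rw [← neg_one_smul ℂ y, ip_smul_right, neg_one_smul]

lemma ip_neg_left (x y : E) : ip (A := A) (-x) y = -ip x y := by
  rw [← star_ip, ip_neg_right, star_neg, star_ip]

lemma ip_sub_right (x y z : E) : ip (A := A) x (y - z) = ip x y - ip x z := by
  rw [sub_eq_add_neg, ip_add_right, ip_neg_right, sub_eq_add_neg]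

lemma ip_sub_left (x y z : E) : ip (A := A) (x - y) z = ip x z - ip y z := by
  rw [sub_eq_add_neg, ip_add_left, ip_neg_left, sub_eq_add_neg]

/-- Two elements with the same inner products against everything coincide. -/
lemma ext_ip {x y : E} (h : ∀ z : E, ip (A := A) z x = ip z y) : x = y := by
  refine sub_eq_zero.mp (eq_zero_of_ip_self (A := A) _ ?_)
  rw [ip_sub_right, h, sub_self]

end InnerModule

/-- The C*-algebra `A` as a right Hilbert `A`-module, with `⟨a, b⟩ = a* b`. -/
instance (A : Type*) [CStarAlgebra A] [PartialOrder A] [StarOrderedRing A] : HilbertModule A A where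
  ip a b := star a * b
  ip_add_right a b c := mul_add _ _ _
  ip_smul_right c a b := mul_smul_comm _ _ _
  ip_op_smul_right a b c := by simp [mul_assoc]
  star_ip a b := by simp
  ip_self_nonneg a := star_mul_self_nonneg a
  eq_zero_of_ip_self a h := (CStarRing.star_mul_self_eq_zero_iff a).mp h
  norm_sq_eq a := by rw [CStarRing.norm_star_mul_self, sq]

section Operators

open InnerModule

variable {A E : Type*} [CStarAlgebra A] [PartialOrder A] [StarOrderedRing A]
  [NormedAddCommGroup E] [NormedSpace ℂ E] [Module Aᵐᵒᵖ E] [HilbertModule A E]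

/-- The Cauchy-Schwarz inequality. -/
lemma norm_ip_le (x y : E) : ‖ip (A := A) x y‖ ≤ ‖x‖ * ‖y‖ := by
  rcases eq_or_ne x 0 with rfl | hx
  · simp [ip_zero_left]
  set s : ℝ := ‖x‖ ^ 2 with hs
  have hs0 : 0 < s := by positivity
  set a : A := ip x y with ha
  have hxx : star a * ip x x * a ≤ s • (star a * a) := by
    rw [hs, HilbertModule.norm_sq_eq (A := A) x]
    exact CStarAlgebra.star_left_conjugate_le_norm_smul (hb := by
      rw [IsSelfAdjoint, star_ip])
  have h0 : 0 ≤ star a * ip x x * a - s • (star a * a) - s • (star a * a) +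
      s • (s • ip (A := A) y y) := by
    have h := ip_self_nonneg (A := A) (op a • x - (s : ℂ) • y)
    have e : star a = ip y x := by rw [ha, star_ip]
    simp only [ip_sub_left, ip_sub_right, ip_op_smul_left, ip_op_smul_right, ip_smul_left,
      ip_smul_right, ← ha, ← e] at h
    simp only [Complex.star_def, Complex.conj_ofReal, Complex.coe_smul] at h
    convert h using 1
    simp only [sub_mul, smul_sub, smul_mul_assoc, mul_assoc]
    abel
  have h1 : s • (star a * a) ≤ s • (s • ip (A := A) y y) := by
    have h := h0.trans (add_le_add_left (sub_le_sub_right (sub_le_sub_right hxx _) _) _)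
    rw [sub_self, zero_sub, neg_add_eq_sub, sub_nonneg] at h
    exact h
  have h2 : star a * a ≤ s • ip (A := A) y y := (smul_le_smul_iff_of_pos_left hs0).mp h1
  have h3 : ‖a‖ ^ 2 ≤ (‖x‖ * ‖y‖) ^ 2 := by
    calc ‖a‖ ^ 2 = ‖star a * a‖ := by rw [CStarRing.norm_star_mul_self, sq]
      _ ≤ ‖s • ip (A := A) y y‖ :=
        CStarAlgebra.norm_le_norm_of_nonneg_of_le (star_mul_self_nonneg a) h2
      _ = (‖x‖ * ‖y‖) ^ 2 := by
        rw [norm_smul, ← HilbertModule.norm_sq_eq, Real.norm_of_nonneg hs0.le, hs, mul_pow]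
  exact (pow_le_pow_iff_left₀ (norm_nonneg _) (by positivity) two_ne_zero).mp h3

lemma norm_op_smul_le (a : A) (x : E) : ‖op a • x‖ ≤ ‖x‖ * ‖a‖ := by
  have h : ‖op a • x‖ ^ 2 ≤ (‖x‖ * ‖a‖) ^ 2 := by
    rw [HilbertModule.norm_sq_eq (A := A), ip_op_smul_left, ip_op_smul_right]
    calc ‖star a * (ip x x * a)‖ ≤ ‖star a‖ * (‖ip (A := A) x x‖ * ‖a‖) :=
          (norm_mul_le _ _).trans (by gcongr; exact norm_mul_le _ _)
      _ = (‖x‖ * ‖a‖) ^ 2 := by rw [← HilbertModule.norm_sq_eq, norm_star]; ring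
  exact (pow_le_pow_iff_left₀ (norm_nonneg _) (by positivity) two_ne_zero).mp h

/-- The rank-one operator `Θ_{x,y} : z ↦ x · ⟨y, z⟩`. -/
def rankOne (A : Type*) {E : Type*} [CStarAlgebra A] [PartialOrder A] [StarOrderedRing A]
    [NormedAddCommGroup E] [NormedSpace ℂ E] [Module Aᵐᵒᵖ E] [HilbertModule A E] (x y : E) :
    E →L[ℂ] E :=
  LinearMap.mkContinuous
    { toFun := fun z => op (ip (A := A) y z) • x
      map_add' := fun z z' => by rw [ip_add_right, MulOpposite.op_add, add_smul]
      map_smul' := fun c z => ext_ip (A := A) fun w => by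
        rw [ip_smul_right, ip_op_smul_right, RingHom.id_apply, ip_smul_right, ip_op_smul_right,
          mul_smul_comm] }
    (‖x‖ * ‖y‖) fun z => by
      refine (norm_op_smul_le _ x).trans ?_
      rw [mul_assoc]
      exact mul_le_mul_of_nonneg_left (norm_ip_le y z) (norm_nonneg x)

variable (A E) in
/-- The compact operators `𝓚(E)`: the closed linear span, in the operator norm, of the rank-one
operators. -/
def compactOperators : Submodule ℂ (E →L[ℂ] E) :=
  (Submodule.span ℂ {T | ∃ x y : E, T = rankOne A x y}).topologicalClosure

variable (A) in
/-- `S` is an adjoint of `T`. -/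
def IsAdjointPair (T S : E →L[ℂ] E) : Prop := ∀ x y, ip (A := A) (T x) y = ip x (S y)

variable (A) in
/-- `T` belongs to the C*-algebra `𝓛(E)` of adjointable operators. -/
def IsAdjointable (T : E →L[ℂ] E) : Prop := ∃ S, IsAdjointPair A T S

end Operators

/-- A left action of the C*-algebra `C` on the right Hilbert `A`-module `E`, given by a
`*`-homomorphism `C → 𝓛(E)`. -/
@[ext] structure LeftAction (C A E : Type*) [CStarAlgebra C] [CStarAlgebra A] [PartialOrder A]
    [StarOrderedRing A] [NormedAddCommGroup E] [NormedSpace ℂ E] [Module Aᵐᵒᵖ E]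
    [HilbertModule A E] where
  toHom : C →ₙₐ[ℂ] (E →L[ℂ] E)
  adjoint : ∀ c, IsAdjointPair A (toHom c) (toHom (star c))

/-! ### Balanced tensor products -/

section Tensor

open InnerModule TensorProduct

variable {C A X Y : Type*} [CStarAlgebra C] [PartialOrder C] [StarOrderedRing C]
  [CStarAlgebra A] [PartialOrder A] [StarOrderedRing A]
  [AddCommGroup X] [Module ℂ X] [Module Cᵐᵒᵖ X] [InnerModule C X]
  [NormedAddCommGroup Y] [NormedSpace ℂ Y] [Module Aᵐᵒᵖ Y] [HilbertModule A Y]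

variable (X) in
/-- The subspace of the algebraic tensor product spanned by the elements
`(x · c) ⊙ y - x ⊙ (c · y)`. -/
def balancingSubspace (φ : LeftAction C A Y) : Submodule ℂ (X ⊗[ℂ] Y) :=
  Submodule.span ℂ {t | ∃ (x : X) (c : C) (y : Y), t = (op c • x) ⊗ₜ y - x ⊗ₜ φ.toHom c y}

variable (X) in
/-- The algebraic balanced tensor product `X ⊙_C Y`. -/
abbrev AlgTensor (φ : LeftAction C A Y) : Type _ := (X ⊗[ℂ] Y) ⧸ balancingSubspace X φ

/-- The elementary tensor `x ⊗ y` in `X ⊙_C Y`. -/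
def AlgTensor.tmul (φ : LeftAction C A Y) (x : X) (y : Y) : AlgTensor X φ :=
  (balancingSubspace X φ).mkQ (x ⊗ₜ y)

variable (X) in
/-- The sesquilinear form on `X ⊙ Y` with
`⟨x ⊙ y, x' ⊙ y'⟩ = ⟨y, ⟨x, x'⟩ · y'⟩`. -/
def preForm (φ : LeftAction C A Y) : (X ⊗[ℂ] Y) →ₗ⋆[ℂ] (X ⊗[ℂ] Y) →ₗ[ℂ] A :=
  TensorProduct.lift <| LinearMap.mk₂'ₛₗ (starRingEnd ℂ) (starRingEnd ℂ)
    (fun x y => TensorProduct.lift <| LinearMap.mk₂ ℂ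
      (fun x' y' => ip (A := A) y (φ.toHom (ip (A := C) x x') y'))
      (fun x₁ x₂ y' => by
        rw [ip_add_right, map_add, add_apply, ip_add_right])
      (fun c x' y' => by
        rw [ip_smul_right, map_smul, smul_apply, ip_smul_right])
      (fun x' y₁ y₂ => by rw [map_add, ip_add_right])
      (fun c x' y' => by rw [map_smul, ip_smul_right]))
    (fun x₁ x₂ y => TensorProduct.ext' fun x' y' => by
      simp [ip_add_left, ip_add_right])
    (fun c x y => TensorProduct.ext' fun x' y' => by
      simp [ip_smul_left, ip_smul_right])
    (fun x y₁ y₂ => TensorProduct.ext' fun x' y' => by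
      simp [ip_add_left])
    (fun c x y => TensorProduct.ext' fun x' y' => by
      simp [ip_smul_left])

lemma preForm_tmul (φ : LeftAction C A Y) (x x' : X) (y y' : Y) :
    preForm X φ (x ⊗ₜ y) (x' ⊗ₜ y') = ip y (φ.toHom (ip x x') y') := rfl

lemma preForm_star (φ : LeftAction C A Y) (t t' : X ⊗[ℂ] Y) :
    star (preForm X φ t t') = preForm X φ t' t := by
  induction t with
  | zero => simp
  | add t₁ t₂ h₁ h₂ => simp [h₁, h₂]
  | tmul x y =>
    induction t' with
    | zero => simp
    | add t₁ t₂ h₁ h₂ => simp [h₁, h₂]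
    | tmul x' y' => rw [preForm_tmul, preForm_tmul, star_ip, φ.adjoint, star_ip]

lemma preForm_balanced (φ : LeftAction C A Y) (t t' : X ⊗[ℂ] Y)
    (h : t' ∈ balancingSubspace X φ) : preForm X φ t t' = 0 := by
  suffices balancingSubspace X φ ≤ LinearMap.ker (preForm X φ t) from this h
  refine Submodule.span_le.mpr ?_
  rintro _ ⟨x', c, y', rfl⟩
  rw [SetLike.mem_coe, LinearMap.mem_ker, map_sub, sub_eq_zero]
  induction t with
  | zero => simp
  | add t₁ t₂ h₁ h₂ => simp [h₁, h₂]
  | tmul x y => rw [preForm_tmul, preForm_tmul, ip_op_smul_right, map_mul]; rfl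

/-- The `A`-valued inner product on `X ⊙_C Y` determined by
`⟨x ⊗ y, x' ⊗ y'⟩ = ⟨y, ⟨x, x'⟩ · y'⟩`. -/
def AlgTensor.form (φ : LeftAction C A Y) : AlgTensor X φ →ₗ⋆[ℂ] AlgTensor X φ →ₗ[ℂ] A :=
  Submodule.liftQ _
    { toFun := fun t => (balancingSubspace X φ).liftQ (preForm X φ t)
        fun t' h => LinearMap.mem_ker.mpr (preForm_balanced φ t t' h)
      map_add' := fun t₁ t₂ => Submodule.linearMap_qext _ <| LinearMap.ext fun t' =>
        congrArg (fun f => f t') (map_add (preForm X φ) t₁ t₂)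
      map_smul' := fun c t => Submodule.linearMap_qext _ <| LinearMap.ext fun t' =>
        congrArg (fun f => f t') (map_smulₛₗ (preForm X φ) c t) }
    fun t h => LinearMap.mem_ker.mpr <| Submodule.linearMap_qext _ <| LinearMap.ext fun t' => by
      change preForm X φ t t' = 0
      rw [← preForm_star, preForm_balanced φ t' t h, star_zero]

lemma AlgTensor.form_tmul (φ : LeftAction C A Y) (x x' : X) (y y' : Y) :
    form φ (tmul φ x y) (tmul φ x' y') = ip y (φ.toHom (ip x x') y') := rfl

/-- The linear map `π : X ⊙_C Y → Z` into the right Hilbert `A`-module `Z` extends to an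
isomorphism of right Hilbert `A`-modules of `X ⊗_C Y`, the completion of `X ⊙_C Y` in its inner
product, onto `Z`: it intertwines the inner products and the right actions, and has dense range. -/
structure IsTensorIso {Z : Type*} [NormedAddCommGroup Z] [NormedSpace ℂ Z] [Module Aᵐᵒᵖ Z]
    [HilbertModule A Z] (φ : LeftAction C A Y) (π : AlgTensor X φ →ₗ[ℂ] Z) : Prop where
  ip_eq : ∀ t t', ip (π t) (π t') = AlgTensor.form φ t t'
  right : ∀ (x : X) (y : Y) (a : A),
    π (AlgTensor.tmul φ x (op a • y)) = op a • π (AlgTensor.tmul φ x y)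
  dense : DenseRange π

end Tensor

/-! ### Product systems -/

/-- A product system over `P` of right Hilbert `A`-bimodules with fibres `M p`. The multiplication
of `M p` and `M q` takes values in `M r` for any `r` given with a proof of `p + q = r`, which avoids
transporting elements along equalities of indices. The fibre `M 0` is identified with the standard
bimodule `A` through the isomorphism `unit`. -/
@[ext] structure ProductSystem (A : Type*) [CStarAlgebra A] [PartialOrder A] [StarOrderedRing A]
    {P : Type*} [AddMonoid P] (M : P → Type*) [∀ p, NormedAddCommGroup (M p)]
    [∀ p, NormedSpace ℂ (M p)] [∀ p, Module Aᵐᵒᵖ (M p)] [∀ p, HilbertModule A (M p)] where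
  /-- the left action of `A` on each fibre -/
  left : ∀ p, LeftAction A A (M p)
  /-- the identification of the standard bimodule with `M 0` -/
  unit : A ≃ₗ[ℂ] M 0
  unit_ip : ∀ a b, InnerModule.ip (unit a) (unit b) = star a * b
  unit_right : ∀ a b, unit (a * b) = op b • unit a
  unit_left : ∀ a b, unit (a * b) = (left 0).toHom a (unit b)
  /-- the multiplication -/
  mul : ∀ {p q r : P}, p + q = r → (M p →ₗ[ℂ] M q →ₗ[ℂ] M r)
  /-- associativity -/
  mul_assoc : ∀ {p q r pq qr pqr : P} (h₁ : p + q = pq) (h₂ : q + r = qr) (h₃ : pq + r = pqr)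
    (h₄ : p + qr = pqr) (x : M p) (y : M q) (z : M r),
    mul h₃ (mul h₁ x y) z = mul h₄ x (mul h₂ y z)
  /-- the multiplication descends to an isomorphism of bimodules `M p ⊗_A M q → M (p + q)` -/
  mul_iso : ∀ {p q r : P} (h : p + q = r), ∃ π : AlgTensor (M p) (left q) →ₗ[ℂ] M r,
    (∀ x y, π (AlgTensor.tmul (left q) x y) = mul h x y) ∧ IsTensorIso (left q) π ∧
      ∀ a x y, π (AlgTensor.tmul (left q) ((left p).toHom a x) y) =
        (left r).toHom a (π (AlgTensor.tmul (left q) x y))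
  unit_mul : ∀ {p : P} (a : A) (x : M p), mul (zero_add p) (unit a) x = (left p).toHom a x
  mul_unit : ∀ {p : P} (a : A) (x : M p), mul (add_zero p) x (unit a) = op a • x

namespace ProductSystem

variable {A : Type*} [CStarAlgebra A] [PartialOrder A] [StarOrderedRing A]
    {P : Type*} [AddMonoid P] {M : P → Type*} [∀ p, NormedAddCommGroup (M p)]
    [∀ p, NormedSpace ℂ (M p)] [∀ p, Module Aᵐᵒᵖ (M p)] [∀ p, HilbertModule A (M p)]

/-- Every fibre is essential. -/
def IsEssential (S : ProductSystem A M) : Prop := ∀ p (x : M p), (S.left p).toHom 1 x = x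

/-- `A` acts on the left of every fibre by compact operators. -/
def ActsByCompacts (S : ProductSystem A M) : Prop :=
  ∀ p a, (S.left p).toHom a ∈ compactOperators A (M p)

/-- `T'` is the operator `T_p^r = π ∘ (T ⊗ 1) ∘ π⁻¹` on `M r` (where `p ≤ r`) that is induced by the
operator `T` on `M p`, that is, `T' (x y) = T(x) y` for `x ∈ M p` and `y ∈ M q` with `p + q = r`. -/
def IsAmplification (S : ProductSystem A M) {p r : P} (T : M p →L[ℂ] M p) (T' : M r →L[ℂ] M r) :
    Prop :=
  IsAdjointable A T' ∧
    ∀ (q : P) (h : p + q = r) (x : M p) (y : M q), T' (S.mul h x y) = S.mul h (T x) y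

end ProductSystem

/-- A product system over `ℕ^k` is compactly aligned if `T_p^{p ∨ q} T'_q^{p ∨ q}` is compact for
all compact operators `T` on `M p` and `T'` on `M q`. -/
def ProductSystem.IsCompactlyAligned {A : Type*} [CStarAlgebra A] [PartialOrder A]
    [StarOrderedRing A] {k : ℕ} {M : (Fin k → ℕ) → Type*} [∀ p, NormedAddCommGroup (M p)]
    [∀ p, NormedSpace ℂ (M p)] [∀ p, Module Aᵐᵒᵖ (M p)] [∀ p, HilbertModule A (M p)]
    (S : ProductSystem A M) : Prop :=
  ∀ (p q : Fin k → ℕ), ∀ T ∈ compactOperators A (M p), ∀ T' ∈ compactOperators A (M q),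
    ∃ U U' : M (p ⊔ q) →L[ℂ] M (p ⊔ q),
      S.IsAmplification T U ∧ S.IsAmplification T' U' ∧ U ∘L U' ∈ compactOperators A (M (p ⊔ q))

end SSGA

/-! ### Direct sums of corners -/

namespace SSGA

open MulOpposite

section CornerSum

variable {A : Type*} [CStarAlgebra A] {ι : Type*}

/-- The tuples `m ∈ A^ι` with `m j ∈ P j A`, as a subspace. -/
def cornerSubmodule (P : ι → A) : Submodule ℂ (ι → A) where
  carrier := {m | ∀ j, P j * m j = m j}
  add_mem' ha hb j := by rw [Pi.add_apply, mul_add, ha j, hb j]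
  zero_mem' j := mul_zero _
  smul_mem' c m hm j := by rw [Pi.smul_apply, mul_smul_comm, hm j]

/-- The right Hilbert `A`-module `⨁_j P j A` for a finite family of projections `P j` of `A`, with
`⟨m, n⟩ = ∑ j, (m j)* (n j)` and `(m · a) j = (m j) a`. -/
def CornerSum (P : ι → A) : Type _ := cornerSubmodule P

namespace CornerSum

variable {P : ι → A}

instance : AddCommGroup (CornerSum P) := inferInstanceAs (AddCommGroup (cornerSubmodule P))
instance : Module ℂ (CornerSum P) := inferInstanceAs (Module ℂ (cornerSubmodule P))

/-- The coordinates of an element of `⨁_j P j A`. -/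
def coord (m : CornerSum P) : ι → A := m.1

@[ext] lemma ext {m n : CornerSum P} (h : ∀ j, coord m j = coord n j) : m = n :=
  Subtype.ext (funext h)

lemma coord_add (m n : CornerSum P) (j : ι) : coord (m + n) j = coord m j + coord n j := rfl
lemma coord_smul (c : ℂ) (m : CornerSum P) (j : ι) : coord (c • m) j = c • coord m j := rfl
lemma coord_zero (j : ι) : coord (0 : CornerSum P) j = 0 := rfl
lemma coord_mem (m : CornerSum P) (j : ι) : P j * coord m j = coord m j := m.2 j

instance : SMul Aᵐᵒᵖ (CornerSum P) :=
  ⟨fun a m => ⟨fun j => m.1 j * unop a, fun j => by rw [← mul_assoc, m.2 j]⟩⟩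

lemma coord_op_smul (a : Aᵐᵒᵖ) (m : CornerSum P) (j : ι) : coord (a • m) j = coord m j * unop a :=
  rfl

instance : Module Aᵐᵒᵖ (CornerSum P) where
  one_smul m := ext fun j => mul_one _
  mul_smul a b m := ext fun j => by simp [coord_op_smul, mul_assoc]
  smul_zero a := ext fun j => zero_mul _
  smul_add a m n := ext fun j => add_mul _ _ _
  add_smul a b m := ext fun j => mul_add _ _ _
  zero_smul m := ext fun j => mul_zero _

open Classical in
/-- The element of `⨁_j P j A` with entry `P j a` at `j` and `0` elsewhere. -/
def single (hP : ∀ j, P j * P j = P j) (j : ι) (a : A) : CornerSum P :=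
  ⟨Pi.single j (P j * a), fun l => by
    rcases eq_or_ne l j with rfl | h
    · rw [Pi.single_eq_same, ← mul_assoc, hP]
    · rw [Pi.single_eq_of_ne h, mul_zero]⟩

/-- The map `m ↦ m*` into Mathlib's standard module `A^ι` with inner product `∑ j, (y j) (x j)*`,
used to define the norm. -/
def starEmb : CornerSum P →+ WithCStarModule A (ι → A) where
  toFun m := (WithCStarModule.equiv A (ι → A)).symm fun j => star (coord m j)
  map_zero' := WithCStarModule.ext fun _ => star_zero A
  map_add' m n := WithCStarModule.ext fun j => star_add (coord m j) (coord n j)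

lemma starEmb_apply (m : CornerSum P) (j : ι) : starEmb m j = star (coord m j) := rfl

lemma starEmb_injective : Function.Injective (starEmb : CornerSum P → WithCStarModule A (ι → A)) :=
  fun _ _ h => ext fun j => star_injective (congrArg (fun x : WithCStarModule A (ι → A) => x j) h)

lemma isClosed_range_starEmb :
    IsClosed (Set.range (starEmb : CornerSum P → WithCStarModule A (ι → A))) := by
  have h : Set.range (starEmb : CornerSum P → WithCStarModule A (ι → A)) =
      {x | ∀ j, x j * star (P j) = x j} := by
    ext x
    constructor
    · rintro ⟨m, rfl⟩ j
      rw [starEmb_apply, ← star_mul, coord_mem]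
    · intro hx
      refine ⟨⟨fun j => star (x j), fun j => ?_⟩, WithCStarModule.ext fun j => star_star _⟩
      rw [← star_star (P j), ← star_mul, hx j]
  rw [h, Set.ofPred_forall]
  refine isClosed_iInter fun j => ?_
  have hc : Continuous fun x : WithCStarModule A (ι → A) => x j :=
    (continuous_apply j).comp (WithCStarModule.uniformEquiv (A := A) (E := ι → A)).continuous
  exact isClosed_eq (hc.mul continuous_const) hc

variable [PartialOrder A] [StarOrderedRing A] [Fintype ι]

instance : NormedAddCommGroup (CornerSum P) :=
  NormedAddCommGroup.induced _ _ (starEmb (P := P)) starEmb_injective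

lemma norm_eq (m : CornerSum P) : ‖m‖ = ‖starEmb m‖ := rfl

lemma norm_eq_sqrt (m : CornerSum P) : ‖m‖ = √‖∑ j, star (coord m j) * coord m j‖ := by
  rw [norm_eq, WithCStarModule.pi_norm]
  simp only [WithCStarModule.inner_def, starEmb_apply, star_star]

instance : NormedSpace ℂ (CornerSum P) where
  norm_smul_le c m := by
    have h : starEmb (c • m) = star c • starEmb m :=
      WithCStarModule.ext fun j => star_smul c (coord m j)
    rw [norm_eq, h, norm_smul, norm_star, norm_eq]

instance : HilbertModule A (CornerSum P) where
  ip m n := ∑ j, star (coord m j) * coord n j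
  ip_add_right m n n' := by simp [coord_add, mul_add, Finset.sum_add_distrib]
  ip_smul_right c m n := by simp [coord_smul, Finset.smul_sum]
  ip_op_smul_right a m n := by simp [coord_op_smul, Finset.sum_mul, mul_assoc]
  star_ip m n := by simp [star_sum]
  ip_self_nonneg m := Finset.sum_nonneg fun j _ => star_mul_self_nonneg _
  eq_zero_of_ip_self m h := by
    rw [← norm_eq_zero, norm_eq_sqrt, h, norm_zero, Real.sqrt_zero]
  norm_sq_eq m := by rw [norm_eq_sqrt, Real.sq_sqrt (norm_nonneg _)]
  toCompleteSpace := by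
    have hi : Isometry (starEmb : CornerSum P → WithCStarModule A (ι → A)) :=
      AddMonoidHomClass.isometry_of_norm _ fun m => rfl
    exact (completeSpace_iff_isComplete_range hi.isUniformInducing).mpr
      isClosed_range_starEmb.isComplete

lemma ip_def (m n : CornerSum P) :
    InnerModule.ip (A := A) m n = ∑ j, star (coord m j) * coord n j := rfl

end CornerSum

end CornerSum

/-! ### Directed graphs -/

universe u v w

/-- A directed graph with vertex set `V`. -/
structure DiGraph (V : Type u) where
  Edge : Type w
  r : Edge → V
  s : Edge → V

namespace DiGraph

variable {V : Type u} (E : DiGraph.{u, w} V)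

/-- `E.IsPath v [e₁, …, eₙ]` says that `e₁ ⋯ eₙ` is a path of `E` with range `v`, that is, `r e₁ = v`
and `s eᵢ = r eᵢ₊₁`. The empty list is the path of length `0` at `v`. -/
def IsPath : V → List E.Edge → Prop
  | _, [] => True
  | v, e :: l => E.r e = v ∧ IsPath (E.s e) l

/-- The set `v E*` of finite paths with range `v`. -/
abbrev PathsFrom (v : V) := {l : List E.Edge // E.IsPath v l}

/-- A partial isomorphism of the path space `E*`: a length-preserving bijection `v E* → w E*` which
maps `l e` into `g(l) E¹`. -/
structure PIso (v w : V) where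
  toEquiv : E.PathsFrom v ≃ E.PathsFrom w
  length_eq : ∀ l, (toEquiv l).1.length = l.1.length
  initial : ∀ (l : E.PathsFrom v) (e : E.Edge) (h : E.IsPath v (l.1 ++ [e])),
    ∃ e', (toEquiv ⟨l.1 ++ [e], h⟩).1 = (toEquiv l).1 ++ [e']

/-- An action by partial isomorphisms of a groupoid with unit space `V` on the path space of `E`. -/
structure Action [Groupoid.{v} V] where
  φ : ∀ {x y : V}, (x ⟶ y) → E.PIso x y
  comp : ∀ {x y z : V} (h : x ⟶ y) (g : y ⟶ z) (l : E.PathsFrom x),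
    (φ (h ≫ g)).toEquiv l = (φ g).toEquiv ((φ h).toEquiv l)

/-- The action is self-similar: for all `g` and all `e ∈ dom(g) E¹` there are `e' = g · e` and an arrow
`h` from `s(e)` to `s(e')` with `g · (e l) = e' (h · l)` for all `l ∈ s(e) E*`. -/
def Action.IsSelfSimilar {E : DiGraph.{u, w} V} [Groupoid.{v} V] (ψ : E.Action) : Prop :=
  ∀ {x y : V} (g : x ⟶ y) (e : E.Edge) (he : E.r e = x), ∃ (e' : E.Edge) (h : E.s e ⟶ E.s e'),
    ∀ l : E.PathsFrom (E.s e),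
      ((ψ.φ g).toEquiv ⟨e :: l.1, he, l.2⟩).1 = e' :: ((ψ.φ h).toEquiv l).1

/-- The graph bimodule `X(E)` of a finite directed graph `E`, whose elements are the functions
`E¹ → ℂ`. -/
def GraphModule : Type _ := E.Edge → ℂ

namespace GraphModule

variable {E}

instance : AddCommGroup E.GraphModule := inferInstanceAs (AddCommGroup (E.Edge → ℂ))
instance : Module ℂ E.GraphModule := inferInstanceAs (Module ℂ (E.Edge → ℂ))

/-- The value of `x ∈ X(E)` at an edge. -/
def val (x : E.GraphModule) : E.Edge → ℂ := x

/-- The right action `(x · f)(e) = x(e) f(s e)` of `C(E⁰)`. -/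
instance : SMul (V → ℂ)ᵐᵒᵖ E.GraphModule := ⟨fun f x e => val x e * unop f (E.s e)⟩

instance : Module (V → ℂ)ᵐᵒᵖ E.GraphModule where
  one_smul x := funext fun e => mul_one _
  mul_smul f g x := funext fun e =>
    show val x e * (unop g (E.s e) * unop f (E.s e)) = val x e * unop g (E.s e) * unop f (E.s e) by
      ring
  smul_zero f := funext fun e => zero_mul _
  smul_add f x y := funext fun e => add_mul _ _ _
  add_smul f g x := funext fun e => mul_add _ _ _
  zero_smul x := funext fun e => mul_zero _

open Classical in
/-- The inner product `⟨x, y⟩(v) = ∑_{s e = v} conj (x e) (y e)` with values in `C(E⁰)`. -/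
instance [Fintype V] [Fintype E.Edge] : InnerModule (V → ℂ) E.GraphModule where
  ip x y v := ∑ e with E.s e = v, star (val x e) * val y e
  ip_add_right x y z := funext fun v => by
    simp only [Pi.add_apply, ← Finset.sum_add_distrib, ← mul_add]
    rfl
  ip_smul_right c x y := funext fun v => by
    simp only [Pi.smul_apply, smul_eq_mul, Finset.mul_sum]
    exact Finset.sum_congr rfl fun e _ => mul_left_comm _ _ _
  ip_op_smul_right f x y := funext fun v => by
    simp only [Pi.mul_apply, Finset.sum_mul]
    refine Finset.sum_congr rfl fun e he => ?_
    rw [← (Finset.mem_filter.mp he).2]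
    exact (mul_assoc _ _ _).symm
  star_ip x y := funext fun v => by
    simp only [Pi.star_apply, star_sum, star_mul', star_star]
    exact Finset.sum_congr rfl fun e _ => mul_comm _ _
  ip_self_nonneg x v := Finset.sum_nonneg fun e _ => star_mul_self_nonneg _
  eq_zero_of_ip_self x h := funext fun e => by
    have h1 := (Finset.sum_eq_zero_iff_of_nonneg fun e _ => star_mul_self_nonneg (val x e)).mp
      (congrFun h (E.s e)) e (by simp)
    exact (CStarRing.star_mul_self_eq_zero_iff _).mp h1

end GraphModule

end DiGraph

/-! ### Higher-rank graphs and self-similar actions -/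

/-- A `k`-graph with vertex set `V`: a small category with set of morphisms `Path`, identified with
its range and source maps, its identities `id v` and its composition `l m` (defined when
`s l = r m`), together with a degree functor `d` to `ℕ^k` that has the factorisation property. -/
structure KGraph (k : ℕ) (V : Type u) where
  Path : Type w
  r : Path → V
  s : Path → V
  id : V → Path
  comp : ∀ l m : Path, s l = r m → Path
  r_id : ∀ v, r (id v) = v
  s_id : ∀ v, s (id v) = v
  r_comp : ∀ l m h, r (comp l m h) = r l
  s_comp : ∀ l m h, s (comp l m h) = s m
  id_comp : ∀ l, comp (id (r l)) l (s_id _) = l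
  comp_id : ∀ l, comp l (id (s l)) (r_id _).symm = l
  assoc : ∀ l m n h h', comp (comp l m h) n ((s_comp l m h).trans h') =
    comp l (comp m n h') (h.trans (r_comp m n h').symm)
  d : Path → (Fin k → ℕ)
  d_id : ∀ v, d (id v) = 0
  d_comp : ∀ l m h, d (comp l m h) = d l + d m
  factorisation : ∀ l p q, d l = p + q →
    ∃! m : Path × Path, d m.1 = p ∧ d m.2 = q ∧ ∃ h, comp m.1 m.2 h = l

namespace KGraph

variable {k : ℕ} {V : Type u} (Λ : KGraph.{u, w} k V)

/-- The set `Λ^p` of paths of degree `p`. -/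
abbrev Deg (p : Fin k → ℕ) := {l : Λ.Path // Λ.d l = p}

/-- The set `v Λ` of paths with range `v`. -/
abbrev PathsFrom (v : V) := {l : Λ.Path // Λ.r l = v}

/-- An edge is a path whose degree is a standard generator of `ℕ^k`. -/
def IsEdge (e : Λ.Path) : Prop := ∃ i, Λ.d e = Pi.single i 1

/-- The directed graph `Λ_p = (Λ⁰, Λ^p, r, s)`. -/
def graph (p : Fin k → ℕ) : DiGraph.{u, w} V where
  Edge := Λ.Deg p
  r e := Λ.r e.1
  s e := Λ.s e.1

/-- A partial isomorphism of `Λ`: a degree-preserving bijection `v Λ → w Λ` which maps `l e` into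
`g(l) Λ` for all edges `e`. -/
structure PIso (v w : V) where
  toEquiv : Λ.PathsFrom v ≃ Λ.PathsFrom w
  d_eq : ∀ l, Λ.d (toEquiv l).1 = Λ.d l.1
  initial : ∀ (l : Λ.PathsFrom v) (e : Λ.Path) (h : Λ.s l.1 = Λ.r e), Λ.IsEdge e →
    ∃ m h', (toEquiv ⟨Λ.comp l.1 e h, (Λ.r_comp _ _ _).trans l.2⟩).1 =
      Λ.comp (toEquiv l).1 m h'

/-- A self-similar action on `Λ` of a groupoid `G` with unit space `V = Λ⁰`: a faithful homomorphism
`φ` from `G` to the groupoid of partial isomorphisms of `Λ` (over the identity of `V`) such that for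
all `g ∈ G` and all edges `e ∈ dom(g) Λ` there is `h ∈ G` with `g · (e l) = (g · e) (h · l)` for all
`l ∈ s(e) Λ`. -/
structure SelfSimilarAction [Groupoid.{v} V] where
  φ : ∀ {x y : V}, (x ⟶ y) → Λ.PIso x y
  comp : ∀ {x y z : V} (h : x ⟶ y) (g : y ⟶ z) (l : Λ.PathsFrom x),
    (φ (h ≫ g)).toEquiv l = (φ g).toEquiv ((φ h).toEquiv l)
  faithful : ∀ {x y : V} (g h : x ⟶ y), (∀ l, (φ g).toEquiv l = (φ h).toEquiv l) → g = h
  self_similar : ∀ {x y : V} (g : x ⟶ y) (e : Λ.PathsFrom x), Λ.IsEdge e.1 →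
    ∃ h : Λ.s e.1 ⟶ Λ.s ((φ g).toEquiv e).1, ∀ l : Λ.PathsFrom (Λ.s e.1),
      ((φ g).toEquiv ⟨Λ.comp e.1 l.1 l.2.symm, (Λ.r_comp _ _ _).trans e.2⟩).1 =
        Λ.comp ((φ g).toEquiv e).1 ((φ h).toEquiv l).1 ((φ h).toEquiv l).2.symm

variable {Λ}

lemma eq_id_of_d_eq_zero {l : Λ.Path} (h : Λ.d l = 0) : l = Λ.id (Λ.r l) := by
  obtain ⟨m, -, hm⟩ := Λ.factorisation l 0 0 (by simpa using h)
  have h1 := hm (l, Λ.id (Λ.s l)) ⟨h, Λ.d_id _, (Λ.r_id _).symm, Λ.comp_id l⟩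
  have h2 := hm (Λ.id (Λ.r l), l) ⟨Λ.d_id _, h, Λ.s_id _, Λ.id_comp l⟩
  exact congrArg Prod.fst (h1.trans h2.symm)

lemma comp_left_cancel {l m m' : Λ.Path} {h : Λ.s l = Λ.r m} {h' : Λ.s l = Λ.r m'}
    (e : Λ.comp l m h = Λ.comp l m' h') : m = m' := by
  obtain ⟨n, -, hn⟩ := Λ.factorisation _ _ _ (Λ.d_comp l m h)
  have hd : Λ.d m' = Λ.d m := by
    have := congrArg Λ.d e
    rw [Λ.d_comp, Λ.d_comp] at this
    exact (add_left_cancel this).symm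
  have h1 := hn (l, m) ⟨rfl, rfl, h, rfl⟩
  have h2 := hn (l, m') ⟨rfl, hd, h', e.symm⟩
  exact congrArg Prod.snd (h1.trans h2.symm)

lemma comp_congr {l l' m m' : Λ.Path} (hl : l = l') (hm : m = m') {h : Λ.s l = Λ.r m}
    {h' : Λ.s l' = Λ.r m'} : Λ.comp l m h = Λ.comp l' m' h' := by
  subst hl hm
  rfl

lemma id_comp' {l m : Λ.Path} {v : V} (hl : l = Λ.id v) (h : Λ.s l = Λ.r m) :
    Λ.comp l m h = m := by
  subst hl
  rw [Λ.s_id] at h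
  subst h
  exact Λ.id_comp m

namespace SelfSimilarAction

variable [Groupoid.{v} V] (S : Λ.SelfSimilarAction)

/-- The path `g · l`, for `r(l) = dom(g)`. -/
def act {x y : V} (g : x ⟶ y) (l : Λ.Path) (hl : Λ.r l = x) : Λ.Path :=
  ((S.φ g).toEquiv ⟨l, hl⟩).1

lemma r_act {x y : V} (g : x ⟶ y) (l : Λ.Path) (hl : Λ.r l = x) : Λ.r (S.act g l hl) = y :=
  ((S.φ g).toEquiv ⟨l, hl⟩).2

lemma d_act {x y : V} (g : x ⟶ y) (l : Λ.Path) (hl : Λ.r l = x) :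
    Λ.d (S.act g l hl) = Λ.d l := (S.φ g).d_eq _

lemma act_congr {x y : V} (g : x ⟶ y) {l l' : Λ.Path} (e : l = l') (hl : Λ.r l = x)
    (hl' : Λ.r l' = x) : S.act g l hl = S.act g l' hl' := by
  subst e
  rfl

/-- `h` is a restriction of `g` to the path `l`: `g · (l m) = (g · l) (h · m)` for `m ∈ s(l) Λ`. -/
def IsRestriction {x y : V} (g : x ⟶ y) (l : Λ.Path) (hl : Λ.r l = x)
    (h : Λ.s l ⟶ Λ.s (S.act g l hl)) : Prop :=
  ∀ m (hm : Λ.r m = Λ.s l), S.act g (Λ.comp l m hm.symm) ((Λ.r_comp _ _ _).trans hl) =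
    Λ.comp (S.act g l hl) (S.act h m hm) (S.r_act h m hm).symm

lemma exists_restriction_aux (n : ℕ) : ∀ {x y : V} (g : x ⟶ y) (l : Λ.Path) (hl : Λ.r l = x),
    ∑ i, Λ.d l i = n → ∃ (a b : V) (ha : Λ.s l = a) (hb : Λ.s (S.act g l hl) = b) (h : a ⟶ b),
      ∀ m (hm : Λ.r m = a),
        S.act g (Λ.comp l m (ha.trans hm.symm)) ((Λ.r_comp _ _ _).trans hl) =
        Λ.comp (S.act g l hl) (S.act h m hm) (hb.trans (S.r_act h m hm).symm) := by
  induction n with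
  | zero =>
    intro x y g l hl hn
    have hd : Λ.d l = 0 := by
      funext i
      exact (Finset.sum_eq_zero_iff.mp hn) i (Finset.mem_univ i)
    have e1 : l = Λ.id x := by rw [eq_id_of_d_eq_zero hd, hl]
    have e2 : S.act g l hl = Λ.id y := by
      rw [eq_id_of_d_eq_zero ((S.d_act g l hl).trans hd), S.r_act]
    refine ⟨x, y, by rw [e1, Λ.s_id], by rw [e2, Λ.s_id], g, fun m hm => ?_⟩
    exact (S.act_congr g (id_comp' e1 _) _ hm).trans (id_comp' e2 _).symm
  | succ n ih =>
    intro x y g l hl hn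
    obtain ⟨i, hi⟩ : ∃ i, Λ.d l i ≠ 0 := by
      by_contra! h
      simp [h] at hn
    have hfac : Λ.d l = Pi.single i 1 + (Λ.d l - Pi.single i 1) := by
      funext j
      rcases eq_or_ne j i with rfl | hj
      · simp only [Pi.add_apply, Pi.sub_apply, Pi.single_eq_same]
        omega
      · simp [Pi.single_eq_of_ne hj]
    obtain ⟨⟨e, l'⟩, ⟨hde, hdl', hc, rfl⟩, -⟩ := Λ.factorisation l _ _ hfac
    dsimp only at hde hdl' hc hl hn hfac hi ⊢
    have he : Λ.r e = x := (Λ.r_comp _ _ _).symm.trans hl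
    obtain ⟨h, hh⟩ := S.self_similar g ⟨e, he⟩ ⟨i, hde⟩
    have hn' : ∑ j, Λ.d l' j = n := by
      rw [Λ.d_comp] at hn
      simp only [Pi.add_apply, Finset.sum_add_distrib, hde] at hn
      rw [Finset.sum_pi_single'] at hn
      simp at hn
      omega
    obtain ⟨a, b, ha, hb, h', hh'⟩ := ih h l' hc.symm hn'
    have e1 : S.act g (Λ.comp e l' hc) hl =
        Λ.comp (S.act g e he) (S.act h l' hc.symm) (S.r_act h l' hc.symm).symm :=
      hh ⟨l', hc.symm⟩
    refine ⟨a, b, (Λ.s_comp _ _ _).trans ha, ?_, h', fun m hm => ?_⟩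
    · exact (congrArg Λ.s e1).trans ((Λ.s_comp _ _ _).trans hb)
    · have hlm : Λ.s l' = Λ.r m := ha.trans hm.symm
      have e2 := hh ⟨Λ.comp l' m hlm, (Λ.r_comp _ _ _).trans hc.symm⟩
      have e3 : S.act h (Λ.comp l' m hlm) ((Λ.r_comp _ _ _).trans hc.symm) =
        Λ.comp (S.act h l' hc.symm) (S.act h' m hm) (hb.trans (S.r_act h' m hm).symm) := hh' m hm
      calc S.act g (Λ.comp (Λ.comp e l' hc) m _) _
          = S.act g (Λ.comp e (Λ.comp l' m hlm) (hc.trans (Λ.r_comp _ _ _).symm))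
              ((Λ.r_comp _ _ _).trans he) := S.act_congr g (Λ.assoc e l' m hc hlm) _ _
        _ = Λ.comp (S.act g e he) (S.act h (Λ.comp l' m hlm) ((Λ.r_comp _ _ _).trans hc.symm))
              (S.r_act _ _ _).symm := e2
        _ = Λ.comp (S.act g e he) (Λ.comp (S.act h l' hc.symm) (S.act h' m hm)
              (hb.trans (S.r_act h' m hm).symm))
              ((S.r_act h l' hc.symm).symm.trans (Λ.r_comp _ _ _).symm) := comp_congr rfl e3
        _ = Λ.comp (Λ.comp (S.act g e he) (S.act h l' hc.symm) (S.r_act h l' hc.symm).symm)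
              (S.act h' m hm) ((Λ.s_comp _ _ _).trans (hb.trans (S.r_act h' m hm).symm)) :=
            (Λ.assoc _ _ _ _ _).symm
        _ = _ := comp_congr e1.symm rfl

lemma exists_restriction {x y : V} (g : x ⟶ y) (l : Λ.Path) (hl : Λ.r l = x) :
    ∃ h, S.IsRestriction g l hl h := by
  obtain ⟨a, b, ha, hb, h, hh⟩ := S.exists_restriction_aux _ g l hl rfl
  subst ha hb
  exact ⟨h, hh⟩

lemma restriction_unique {x y : V} (g : x ⟶ y) (l : Λ.Path) (hl : Λ.r l = x)
    {h h' : Λ.s l ⟶ Λ.s (S.act g l hl)} (H : S.IsRestriction g l hl h)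
    (H' : S.IsRestriction g l hl h') : h = h' :=
  S.faithful h h' fun m => Subtype.ext (comp_left_cancel ((H m.1 m.2).symm.trans (H' m.1 m.2)))

/-- The restriction `g|_l`: the unique arrow from `s(l)` to `s(g · l)` with
`g · (l m) = (g · l) (g|_l · m)` for all `m ∈ s(l) Λ`. -/
def restrict {x y : V} (g : x ⟶ y) (l : Λ.Path) (hl : Λ.r l = x) :
    Λ.s l ⟶ Λ.s (S.act g l hl) := (S.exists_restriction g l hl).choose

lemma restrict_spec {x y : V} (g : x ⟶ y) (l : Λ.Path) (hl : Λ.r l = x) :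
    S.IsRestriction g l hl (S.restrict g l hl) := (S.exists_restriction g l hl).choose_spec

end SelfSimilarAction

end KGraph

/-! ### The fibres -/

section Fibres

variable {V : Type u} [Groupoid.{v} V] [Fintype V]

namespace GroupoidCStar

lemma i_id_mul_i_id (v : V) : i (𝟙 v) * i (𝟙 v) = i (𝟙 v) := by
  rw [i_mul_i, Category.comp_id]

/-- The homomorphism `C(G⁰) → C*(G)`, `δ_v ↦ i_v`. -/
def vertexHom (f : V → ℂ) : GroupoidCStar V := ∑ v, f v • i (𝟙 v)

lemma vertexHom_mul (f g : V → ℂ) : vertexHom (f * g) = vertexHom f * vertexHom g := by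
  rw [vertexHom, vertexHom, vertexHom, Finset.sum_mul_sum]
  refine Finset.sum_congr rfl fun v _ => ?_
  rw [Finset.sum_eq_single v]
  · rw [smul_mul_smul_comm, i_id_mul_i_id, Pi.mul_apply]
  · intro w _ hw
    rw [smul_mul_smul_comm, i_mul_i_of_ne _ _ hw, smul_zero]
  · simp

lemma vertexHom_star (f : V → ℂ) : vertexHom (star f) = star (vertexHom f) := by
  rw [vertexHom, vertexHom, star_sum]
  refine Finset.sum_congr rfl fun v _ => ?_
  rw [star_smul, star_i, Pi.star_apply, Groupoid.inv_eq_inv, IsIso.inv_id]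

/-- The left action of `C(G⁰)` on `C*(G)` by `f · a = ∑ v, f(v) i_v a`. -/
def vertexAction : LeftAction (V → ℂ) (GroupoidCStar V) (GroupoidCStar V) where
  toHom :=
    { toFun := fun f => ContinuousLinearMap.mul ℂ _ (vertexHom f)
      map_smul' := fun c f => by
        rw [MonoidHom.id_apply, ← map_smul]
        simp [vertexHom, Finset.smul_sum, mul_smul]
      map_zero' := by simp [vertexHom]
      map_add' := fun f g => by
        rw [← map_add]
        simp [vertexHom, add_smul, Finset.sum_add_distrib]
      map_mul' := fun f g => by
        ext a
        simp [vertexHom_mul, mul_assoc] }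
  adjoint f a b := by
    change star (vertexHom f * a) * b = star a * (vertexHom (star f) * b)
    rw [vertexHom_star, star_mul, mul_assoc]

end GroupoidCStar

namespace KGraph

open GroupoidCStar

variable {k : ℕ} (Λ : KGraph.{u, w} k V)

/-- The right Hilbert `C*(G)`-module `M_p = X(Λ_p) ⊗_{C(Λ⁰)} C*(G)`, realised as the direct sum
`⨁_{l ∈ Λ^p} i_{s(l)} C*(G)`. -/
abbrev Fibre (p : Fin k → ℕ) : Type _ :=
  CornerSum fun l : Λ.Deg p => (i (𝟙 (Λ.s l.1)) : GroupoidCStar V)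

/-- The element `δ_l ⊗ a` of `M_p`, that is, `i_{s(l)} a` in the summand at `l ∈ Λ^p`. -/
def δ {p : Fin k → ℕ} (l : Λ.Deg p) (a : GroupoidCStar V) : Λ.Fibre p :=
  CornerSum.single (fun _ => i_id_mul_i_id _) l a

variable {Λ}

/-- The canonical map `X(Λ_p) ⊙_{C(Λ⁰)} C*(G) → M_p`, `x ⊗ a ↦ ∑ l, x(l) (δ_l ⊗ a)`, is well defined
and identifies the Hilbert module `M_p` with `X(Λ_p) ⊗_{C(Λ⁰)} C*(G)`. -/
def FibreIsTensorProduct (Λ : KGraph.{u, w} k V) [∀ p, Fintype (Λ.Deg p)] (p : Fin k → ℕ) : Prop :=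
  letI : Fintype (Λ.graph p).Edge := inferInstanceAs (Fintype (Λ.Deg p))
  ∃ τ : AlgTensor (Λ.graph p).GraphModule (vertexAction (V := V)) →ₗ[ℂ] Λ.Fibre p,
    (∀ x a, τ (AlgTensor.tmul vertexAction x a) =
      ∑ l : Λ.Deg p, DiGraph.GraphModule.val x l • Λ.δ l a) ∧
    IsTensorIso vertexAction τ

namespace SelfSimilarAction

variable (S : Λ.SelfSimilarAction)

/-- The path `g · l ∈ Λ^p` for `l ∈ Λ^p` with `r(l) = dom(g)`. -/
def actDeg {p : Fin k → ℕ} {x y : V} (g : x ⟶ y) (l : Λ.Deg p) (hl : Λ.r l.1 = x) : Λ.Deg p :=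
  ⟨S.act g l.1 hl, (S.d_act g l.1 hl).trans l.2⟩

/-- The path `l (g · m) ∈ Λ^{p + q}` for `l ∈ Λ^p`, `m ∈ Λ^q`, `cod(g) = s(l)` and
`dom(g) = r(m)`. -/
def mulDeg {p q r : Fin k → ℕ} (h : p + q = r) (l : Λ.Deg p) {x : V} (g : x ⟶ Λ.s l.1)
    (m : Λ.Deg q) (hm : Λ.r m.1 = x) : Λ.Deg r :=
  ⟨Λ.comp l.1 (S.act g m.1 hm) (S.r_act g m.1 hm).symm, by
    rw [Λ.d_comp, S.d_act, l.2, m.2, h]⟩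

/-- The vertex `v`, as a path of degree `0`. -/
def vertex (Λ : KGraph.{u, w} k V) (v : V) : Λ.Deg 0 := ⟨Λ.id v, Λ.d_id v⟩

/-- `ψ` is the action of `G` on the path space of `Λ_p` that extends the action of `G` on `Λ^p` and has
the same restriction maps: `g · (e l) = (g · e) (g|_e · l)` for `e ∈ Λ^p`. -/
def IsInducedAction (p : Fin k → ℕ) (ψ : (Λ.graph p).Action) : Prop :=
  ∀ {x y : V} (g : x ⟶ y) (e : Λ.Deg p) (he : Λ.r e.1 = x)
    (l : (Λ.graph p).PathsFrom (Λ.s e.1)),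
    ((ψ.φ g).toEquiv ⟨e :: l.1, he, l.2⟩).1 =
      S.actDeg g e he :: ((ψ.φ (S.restrict g e.1 he)).toEquiv l).1

variable [∀ p, Fintype (Λ.Deg p)]

open Classical in
/-- The multiplication of `M p` and `M q` satisfies
`(δ_l ⊗ i_g) (δ_m ⊗ i_h) = δ_{l (g · m)} ⊗ i_{(g|_m) h}` if `r(m) = dom(g)`, and `= 0` otherwise,
for `s(l) = cod(g)` and `s(m) = cod(h)`. -/
def MulFormula (M : ProductSystem (GroupoidCStar V) fun p => Λ.Fibre p) (p q : Fin k → ℕ) : Prop :=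
  ∀ (r : Fin k → ℕ) (hr : p + q = r) (l : Λ.Deg p) (m : Λ.Deg q) {x y : V} (g : x ⟶ Λ.s l.1)
    (h : y ⟶ Λ.s m.1), M.mul hr (Λ.δ l (i g)) (Λ.δ m (i h)) =
      if hm : Λ.r m.1 = x then Λ.δ (S.mulDeg hr l g m hm) (i (h ≫ S.restrict g m.1 hm)) else 0

open Classical in
/-- The left action of `C*(G)` on `M p` satisfies
`i_g · (δ_l ⊗ a) = δ_{g · l} ⊗ i_{g|_l} a` if `r(l) = dom(g)`, and `= 0` otherwise. -/
def LeftFormula (M : ProductSystem (GroupoidCStar V) fun p => Λ.Fibre p) (p : Fin k → ℕ) : Prop :=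
  ∀ (l : Λ.Deg p) (a : GroupoidCStar V) {x y : V} (g : x ⟶ y),
    (M.left p).toHom (i g) (Λ.δ l a) =
      if hl : Λ.r l.1 = x then Λ.δ (S.actDeg g l hl) (i (S.restrict g l.1 hl) * a) else 0

/-- `M` is a product system whose fibres are the bimodules `M_p` of the self-similar action, whose
fibre `M_0` is identified with `C*(G)` by `i_g ↦ δ_{cod(g)} ⊗ i_g`, and whose multiplication is given
by the multiplication formula for nonzero `p` and `q`. -/
structure IsCanonical (M : ProductSystem (GroupoidCStar V) fun p => Λ.Fibre p) : Prop where
  left : ∀ p, S.LeftFormula M p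
  unit : ∀ {x y : V} (g : x ⟶ y), M.unit (i g) = Λ.δ (vertex Λ y) (i g)
  mul : ∀ p q, p ≠ 0 → q ≠ 0 → S.MulFormula M p q

end SelfSimilarAction

end KGraph

end Fibres

end SSGA

end

noncomputable section

open CategoryTheory
open scoped ComplexOrder

namespace SSGA

universe u v w

open MulOpposite InnerModule

/-! ### Adjointable operators on Hilbert modules. -/

section Operators

variable {A E : Type*} [CStarAlgebra A] [PartialOrder A] [StarOrderedRing A]
  [NormedAddCommGroup E] [NormedSpace ℂ E] [Module Aᵐᵒᵖ E] [HilbertModule A E]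

/-! Finiteness of Λ makes each fibre a finite direct sum of corners, so every element is the finite
sum of its components δ_l ⊗ x(l) (`sum_δ`). Hence every right-linear operator on a fibre is a finite
sum of rank-one operators (`sum_rankOne_δ`): it is adjointable and compact. Compactness of the left
actions and compact alignment then reduce to right linearity.

The left actions come from the restriction identities (gh)|_l = g|_{h·l} h|_l and (g⁻¹)|_{g·l} =
(g|_l)⁻¹, which say that the operators δ_l ⊗ b ↦ δ_{g·l} ⊗ i_{g|_l} b represent G by adjointable
operators (`isRep_opArr`). A representation gives a C*-seminorm on ℂG, which the full norm
dominates, so it extends to C*(G) (`leftActionOfRep`).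

The product is defined on all of M_p × M_q through coordinates: if n = n₁n₂ is the factorisation of
a path into degrees p and q, then (xy)(n) = (x(n₁)·y)(n₂) (`coord_fibreMul`). Associativity follows
from the unique factorisation of n into three pieces and from a(xy) = (ax)y, which encodes g·(lm) =
(g·l)(g|_l·m) and g|_{lm} = (g|_l)|_m. The product preserves inner products because paths of degree
p + q correspond to composable pairs (`ip_fibreMul`), and it reaches every δ_n ⊗ a.

For uniqueness (`IsCanonical.unique`), the left actions are determined by density and the unit by
its value at 1. Products with a degree-zero factor are fixed by the unit axioms; the others are
fixed on the generators δ_l ⊗ 1 by the formula, and then everywhere because multiplication is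
balanced and right linear.

The action on the paths of Λ_p is defined by recursion along the list of edges, passing from g to
its restriction at each edge (`pathAction`). -/

lemma ip_sum_right {ι : Type*} (s : Finset ι) (x : E) (y : ι → E) :
    ip (A := A) x (∑ j ∈ s, y j) = ∑ j ∈ s, ip x (y j) :=
  map_sum (⟨⟨ip (A := A) x, ip_zero_right x⟩, ip_add_right x⟩ : E →+ A) y s

lemma ip_sum_left {ι : Type*} (s : Finset ι) (x : ι → E) (y : E) :
    ip (A := A) (∑ j ∈ s, x j) y = ∑ j ∈ s, ip (x j) y := by
  rw [← star_ip, ip_sum_right, star_sum]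
  exact Finset.sum_congr rfl fun j _ => star_ip _ _

lemma rankOne_apply (x y z : E) : rankOne A x y z = op (ip (A := A) y z) • x := rfl

lemma isAdjointPair_rankOne (x y : E) : IsAdjointPair A (rankOne A x y) (rankOne A y x) := by
  intro z z'
  rw [rankOne_apply, rankOne_apply, ip_op_smul_left, ip_op_smul_right, star_ip]

lemma IsAdjointPair.sum {ι : Type*} {s : Finset ι} {T S : ι → E →L[ℂ] E}
    (h : ∀ j ∈ s, IsAdjointPair A (T j) (S j)) :
    IsAdjointPair A (∑ j ∈ s, T j) (∑ j ∈ s, S j) := by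
  intro x y
  rw [sum_apply, sum_apply, ip_sum_left, ip_sum_right]
  exact Finset.sum_congr rfl fun j hj => h j hj x y

lemma IsAdjointPair.symm {T S : E →L[ℂ] E} (h : IsAdjointPair A T S) : IsAdjointPair A S T :=
  fun x y => by rw [← star_ip, ← h, star_ip]

/-- Inside ⟨z, ·⟩ the operator can be moved to the other side, where the right action comes out.
Right linearity is therefore never an axiom for left actions. -/
lemma IsAdjointPair.map_op_smul {T S : E →L[ℂ] E} (h : IsAdjointPair A T S) (a : A) (x : E) :
    T (op a • x) = op a • T x :=
  ext_ip (A := A) fun z => by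
    rw [← h.symm, ip_op_smul_right, ip_op_smul_right, h.symm]

lemma norm_le_of_ip_le {x y : E} {C : ℝ} (hC : 0 ≤ C)
    (h : ip (A := A) x x ≤ (C ^ 2) • ip y y) : ‖x‖ ≤ C * ‖y‖ := by
  have h1 : ‖x‖ ^ 2 ≤ (C * ‖y‖) ^ 2 := by
    rw [HilbertModule.norm_sq_eq (A := A) x, mul_pow, HilbertModule.norm_sq_eq (A := A) y]
    refine (CStarAlgebra.norm_le_norm_of_nonneg_of_le (ip_self_nonneg x) h).trans ?_
    rw [norm_smul, Real.norm_of_nonneg (by positivity)]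
  exact (pow_le_pow_iff_left₀ (norm_nonneg _) (by positivity) two_ne_zero).mp h1

lemma IsAdjointPair.norm_le {T S : E →L[ℂ] E} (h : IsAdjointPair A T S) : ‖S‖ ≤ ‖T‖ := by
  refine ContinuousLinearMap.opNorm_le_bound _ (norm_nonneg _) fun x => ?_
  rcases (norm_nonneg (S x)).eq_or_lt with h0 | h0
  · rw [← h0]
    positivity
  · refine le_of_mul_le_mul_right ?_ h0
    rw [← sq, HilbertModule.norm_sq_eq (A := A), ← h]
    calc ‖ip (A := A) (T (S x)) x‖ ≤ ‖T (S x)‖ * ‖x‖ := norm_ip_le _ _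
      _ ≤ ‖T‖ * ‖S x‖ * ‖x‖ := by gcongr; exact T.le_opNorm _
      _ = ‖T‖ * ‖x‖ * ‖S x‖ := by ring

/-- The C*-identity, phrased for pairs since no bundled algebra of adjointable operators is used. It
makes the operator norm of a representation a C*-seminorm on ℂG. -/
lemma IsAdjointPair.norm_mul_self {T S : E →L[ℂ] E} (h : IsAdjointPair A T S) :
    ‖S * T‖ = ‖T‖ * ‖T‖ := by
  refine le_antisymm ((norm_mul_le _ _).trans (by gcongr; exact h.norm_le)) ?_
  have h1 : ‖T‖ ≤ √‖S * T‖ := by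
    refine ContinuousLinearMap.opNorm_le_bound _ (Real.sqrt_nonneg _) fun x => ?_
    have h2 : ‖T x‖ ^ 2 ≤ (√‖S * T‖ * ‖x‖) ^ 2 := by
      rw [HilbertModule.norm_sq_eq (A := A), h, mul_pow, Real.sq_sqrt (norm_nonneg _)]
      calc ‖ip (A := A) x (S (T x))‖ ≤ ‖x‖ * ‖(S * T) x‖ := norm_ip_le _ _
        _ ≤ ‖x‖ * (‖S * T‖ * ‖x‖) := by gcongr; exact (S * T).le_opNorm _
        _ = ‖S * T‖ * ‖x‖ ^ 2 := by ring
    exact (pow_le_pow_iff_left₀ (norm_nonneg _) (by positivity) two_ne_zero).mp h2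
  calc ‖T‖ * ‖T‖ ≤ √‖S * T‖ * √‖S * T‖ := mul_self_le_mul_self (norm_nonneg _) h1
    _ = ‖S * T‖ := Real.mul_self_sqrt (norm_nonneg _)

/-! ### Automatic contractivity of left actions. -/

namespace LeftAction

variable {C : Type*} [CStarAlgebra C] (φ : LeftAction C A E)

lemma map_op_smul (c : C) (a : A) (x : E) : φ.toHom c (op a • x) = op a • φ.toHom c x :=
  (φ.adjoint c).map_op_smul a x

lemma toHom_mul_apply (c c' : C) (x : E) : φ.toHom (c * c') x = φ.toHom c (φ.toHom c' x) := by
  rw [map_mul]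
  rfl

/-- Writing ‖c‖²·1 − c*c = b*b gives ⟨cx, cx⟩ = ‖c‖²⟨x, 1·x⟩ − ⟨bx, bx⟩ ≤ ‖c‖²⟨x, x⟩. Neither
continuity nor unitality of the action is assumed. -/
lemma norm_le (c : C) : ‖φ.toHom c‖ ≤ ‖c‖ := by
  let : PartialOrder C := CStarAlgebra.spectralOrder C
  have : StarOrderedRing C := CStarAlgebra.spectralOrderedRing C
  refine ContinuousLinearMap.opNorm_le_bound _ (norm_nonneg _) fun x => ?_
  refine norm_le_of_ip_le (A := A) (norm_nonneg c) ?_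
  have h0 : 0 ≤ algebraMap ℝ C (‖c‖ ^ 2) - star c * c :=
    sub_nonneg.mpr CStarAlgebra.star_mul_le_algebraMap_norm_sq
  obtain ⟨b, hb⟩ := CStarAlgebra.nonneg_iff_eq_star_mul_self.mp h0
  have h1 : φ.toHom (star c * c) x =
      ((‖c‖ ^ 2 : ℝ) : ℂ) • φ.toHom 1 x - φ.toHom (star b * b) x := by
    rw [← hb, map_sub, sub_apply, Algebra.algebraMap_eq_smul_one,
      ← Complex.coe_smul, map_smul, smul_apply, sub_sub_cancel]
  have key (d : C) : ip (A := A) x (φ.toHom (star d * d) x) = ip (φ.toHom d x) (φ.toHom d x) := by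
    rw [φ.adjoint, φ.toHom_mul_apply]
  -- The unit of C acts as a projection, possibly not the identity; positivity of ⟨x − 1·x, x − 1·x⟩
  -- gives the bound.
  have h2 : ip (A := A) x (φ.toHom 1 x) ≤ ip x x := by
    have h3 := ip_self_nonneg (A := A) (x - φ.toHom 1 x)
    have h4 := key 1
    have h5 : ip (A := A) (φ.toHom 1 x) x = ip x (φ.toHom 1 x) := by
      rw [φ.adjoint, star_one]
    rw [star_one, one_mul] at h4
    rwa [ip_sub_left, ip_sub_right, ip_sub_right, h5, ← h4, sub_self, sub_zero,
      sub_nonneg] at h3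
  rw [← key, h1, ip_sub_right, ip_smul_right, key, Complex.coe_smul]
  exact (sub_le_self _ (ip_self_nonneg _)).trans (smul_le_smul_of_nonneg_left h2 (by positivity))

lemma continuous : Continuous φ.toHom := by
  let L : C →L[ℂ] (E →L[ℂ] E) := LinearMap.mkContinuous (φ.toHom : C →ₗ[ℂ] (E →L[ℂ] E)) 1
    fun c => by rw [one_mul]; exact φ.norm_le c
  exact L.continuous

end LeftAction

end Operators

/-! ### The universal property of the full C*-algebra of a groupoid -/

section Universal

variable {V : Type u} [Groupoid.{v} V]

namespace GroupoidAlgebra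

variable {A E : Type*} [CStarAlgebra A] [PartialOrder A] [StarOrderedRing A]
  [NormedAddCommGroup E] [NormedSpace ℂ E] [Module Aᵐᵒᵖ E] [HilbertModule A E]

variable (A) in
/-- A representation of a groupoid by adjointable operators on a Hilbert module. -/
structure IsRep (U : Arr V → E →L[ℂ] E) : Prop where
  mul : ∀ {x y z : V} (g : y ⟶ z) (h : x ⟶ y), U ⟨y, z, g⟩ * U ⟨x, y, h⟩ = U ⟨x, z, h ≫ g⟩
  mul_of_ne : ∀ {a b : Arr V}, b.cod ≠ a.dom → U a * U b = 0
  adjoint : ∀ a, IsAdjointPair A (U a) (U (inv a))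

variable {U : Arr V → E →L[ℂ] E}

lemma IsRep.extend_mul (hU : IsRep A U) (f g : GroupoidAlgebra V) :
    extend U (f * g) = extend U f * extend U g := by
  induction f using induction_pt with
  | hadd f f' hf hf' => rw [add_mul, map_add, hf, hf', map_add, add_mul]
  | hsmul z f hf => rw [smul_mul', map_smul, hf, map_smul, smul_mul_assoc]
  | hzero => rw [zero_mul, map_zero, zero_mul]
  | hpt a =>
    induction g using induction_pt with
    | hadd f f' hf hf' => rw [mul_add, map_add, hf, hf', map_add, mul_add]
    | hsmul z f hf => rw [mul_smul', map_smul, hf, map_smul, mul_smul_comm]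
    | hzero => rw [mul_zero, map_zero, mul_zero]
    | hpt b =>
      rw [pt_mul_pt, extend_pt, extend_pt]
      by_cases h : b.cod = a.dom
      · obtain ⟨_, _, a⟩ := a
        obtain ⟨_, _, b⟩ := b
        dsimp only at h
        subst h
        rw [ptMul_of_eq, extend_pt, hU.mul]
      · rw [ptMul_of_ne h, map_zero, hU.mul_of_ne h]

lemma IsRep.extend_adjoint (hU : IsRep A U) (f : GroupoidAlgebra V) :
    IsAdjointPair A (extend U f) (extend U (star f)) := by
  intro x y
  induction f using induction_pt with
  | hadd f g hf hg =>
    rw [star_add, map_add, map_add, add_apply, add_apply,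
      ip_add_left, ip_add_right, hf, hg]
  | hsmul z f hf =>
    rw [star_smul, map_smul, map_smul, smul_apply,
      smul_apply, ip_smul_left, ip_smul_right, hf]
  | hpt a => rw [star_pt, extend_pt, extend_pt, hU.adjoint]
  | hzero => rw [star_zero, map_zero, zero_apply, zero_apply,
      ip_zero_left, ip_zero_right]

/-- The C*-seminorm of a representation. -/
def IsRep.seminorm (hU : IsRep A U) : CStarSeminorm V :=
  ⟨(normSeminorm ℂ (E →L[ℂ] E)).comp (extend U), by
    constructor
    · intro f g
      simp only [Seminorm.comp_apply, coe_normSeminorm, hU.extend_mul]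
      exact norm_mul_le _ _
    · intro f
      simp only [Seminorm.comp_apply, coe_normSeminorm, hU.extend_mul]
      exact (hU.extend_adjoint f).norm_mul_self⟩

/-- This is the universal property: the full norm is the supremum of all C*-seminorms, and the
representation supplies one of them. -/
lemma IsRep.norm_extend_le [Fintype V] (hU : IsRep A U) (f : GroupoidAlgebra V) :
    ‖extend U f‖ ≤ ‖f‖ := le_maxNorm hU.seminorm f

end GroupoidAlgebra

namespace GroupoidCStar

variable [Fintype V] {A E : Type*} [CStarAlgebra A] [PartialOrder A] [StarOrderedRing A]
  [NormedAddCommGroup E] [NormedSpace ℂ E] [Module Aᵐᵒᵖ E] [HilbertModule A E]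

/-- The canonical map `ℂG → C*(G)` as a linear map. -/
def ofLin : GroupoidAlgebra V →ₗ[ℂ] GroupoidCStar V where
  toFun := of
  map_add' := of_add
  map_smul' := of_smul

/-- Continuous linear maps on `C*(G)` that agree on the generators are equal. -/
lemma eq_of_forall_i {W : Type*} [AddCommMonoid W] [Module ℂ W] [TopologicalSpace W] [T2Space W]
    {f g : GroupoidCStar V →ₗ[ℂ] W} (hf : Continuous f) (hg : Continuous g)
    (h : ∀ {x y : V} (a : x ⟶ y), f (i a) = g (i a)) : f = g := by
  have h1 : f ∘ₗ ofLin = g ∘ₗ ofLin := GroupoidAlgebra.ext_lin fun a => h a.hom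
  ext a
  induction a using induction with
  | hc => exact isClosed_eq hf hg
  | h b => exact LinearMap.congr_fun h1 b

variable {U : Arr V → E →L[ℂ] E}

lemma extendOfNorm_of (hU : GroupoidAlgebra.IsRep A U) (f : GroupoidAlgebra V) :
    haveI : CompleteSpace E := HilbertModule.toCompleteSpace (A := A)
    (GroupoidAlgebra.extend U).extendOfNorm (ofLin (V := V)) (of f) =
      GroupoidAlgebra.extend U f := by
  have : CompleteSpace E := HilbertModule.toCompleteSpace (A := A)
  -- The bound by the norm in C*(G) makes the extension exist, even though ℂG → C*(G) is not known
  -- to be injective.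
  refine LinearMap.extendOfNorm_eq (e := ofLin (V := V)) denseRange_of ⟨1, fun f => ?_⟩ f
  rw [one_mul]
  exact (hU.norm_extend_le f).trans (norm_of f).ge

/-- The left action of `C*(G)` integrating a representation of `G`. -/
def leftActionOfRep (hU : GroupoidAlgebra.IsRep A U) : LeftAction (GroupoidCStar V) A E :=
  haveI : CompleteSpace E := HilbertModule.toCompleteSpace (A := A)
  let L := (GroupoidAlgebra.extend U).extendOfNorm (ofLin (V := V))
  { toHom :=
    { toFun := L
      map_smul' := map_smul L
      map_zero' := map_zero L
      map_add' := map_add L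
      map_mul' := fun a b => by
        refine induction₂ (P := fun a b => L (a * b) = L a * L b) ?_ (fun f g => ?_) a b
        · exact isClosed_eq (L.continuous.comp continuous_mul)
            ((L.continuous.comp continuous_fst).mul (L.continuous.comp continuous_snd))
        · rw [← of_mul, extendOfNorm_of hU, extendOfNorm_of hU, extendOfNorm_of hU, hU.extend_mul] }
    adjoint := fun c x y => by
      change ip (L c x) y = ip x (L (star c) y)
      -- By Cauchy-Schwarz the inner product is continuous in each variable, so the adjoint relation
      -- is a closed condition on `c` and can be tested on ℂG.
      have hip (z : E) : Continuous fun w : E => ip (A := A) z w :=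
        (LinearMap.mkContinuous (⟨⟨ip (A := A) z, ip_add_right z⟩, fun c => ip_smul_right c z⟩ :
          E →ₗ[ℂ] A) ‖z‖ (norm_ip_le z)).continuous
      have hip' (z : E) : Continuous fun w : E => ip (A := A) w z := by
        have := (hip z).star
        simpa only [star_ip] using this
      induction c using induction with
      | hc =>
        exact isClosed_eq
          ((hip' y).comp (((ContinuousLinearMap.apply ℂ E x).continuous).comp L.continuous))
          ((hip x).comp ((((ContinuousLinearMap.apply ℂ E y).continuous).comp L.continuous).comp
            continuous_star'))
      | h f =>
        rw [star_of, extendOfNorm_of hU, extendOfNorm_of hU]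
        exact hU.extend_adjoint f x y }

lemma leftActionOfRep_i (hU : GroupoidAlgebra.IsRep A U) {x y : V} (g : x ⟶ y) :
    (leftActionOfRep hU).toHom (i g) = U ⟨x, y, g⟩ :=
  (extendOfNorm_of hU _).trans (GroupoidAlgebra.extend_pt U _)

/-- Left actions are automatically contractive, so density of the span of the generators suffices.
-/
lemma leftAction_ext {φ ψ : LeftAction (GroupoidCStar V) A E}
    (h : ∀ {x y : V} (g : x ⟶ y), φ.toHom (i g) = ψ.toHom (i g)) : φ = ψ := by
  have h1 : (φ.toHom : GroupoidCStar V →ₗ[ℂ] (E →L[ℂ] E)) = (ψ.toHom : GroupoidCStar V →ₗ[ℂ] _) :=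
    eq_of_forall_i φ.continuous ψ.continuous h
  refine LeftAction.ext (NonUnitalAlgHom.ext fun a => ?_)
  exact LinearMap.congr_fun h1 a

end GroupoidCStar

end Universal

/-! ### Restrictions -/

namespace KGraph

namespace SelfSimilarAction

variable {k : ℕ} {V : Type u} {Λ : KGraph.{u, w} k V} [Groupoid.{v} V] (S : Λ.SelfSimilarAction)

lemma act_comp {x y z : V} (h : x ⟶ y) (g : y ⟶ z) (l : Λ.Path) (hl : Λ.r l = x) :
    S.act (h ≫ g) l hl = S.act g (S.act h l hl) (S.r_act h l hl) :=
  congrArg Subtype.val (S.comp h g ⟨l, hl⟩)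

/-- An action is only required to respect composition; a unit acts as an idempotent bijection, hence
as the identity. -/
lemma act_id {x : V} (l : Λ.Path) (hl : Λ.r l = x) : S.act (𝟙 x) l hl = l := by
  have h := S.comp (𝟙 x) (𝟙 x) ⟨l, hl⟩
  rw [Category.comp_id] at h
  exact congrArg Subtype.val ((S.φ (𝟙 x)).toEquiv.injective h).symm

lemma act_inv_act {x y : V} (g : x ⟶ y) (l : Λ.Path) (hl : Λ.r l = x) :
    S.act (Groupoid.inv g) (S.act g l hl) (S.r_act g l hl) = l := by
  rw [← S.act_comp, Groupoid.comp_inv, S.act_id]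

lemma act_act_inv {x y : V} (g : x ⟶ y) (l : Λ.Path) (hl : Λ.r l = y) :
    S.act g (S.act (Groupoid.inv g) l hl) (S.r_act _ l hl) = l := by
  rw [← S.act_comp, Groupoid.inv_comp, S.act_id]

lemma act_comp_path {x y : V} (g : x ⟶ y) (l : Λ.Path) (hl : Λ.r l = x) (m : Λ.Path)
    (hm : Λ.s l = Λ.r m) (h : Λ.r (Λ.comp l m hm) = x) :
    S.act g (Λ.comp l m hm) h =
      Λ.comp (S.act g l hl) (S.act (S.restrict g l hl) m hm.symm) (S.r_act _ _ _).symm :=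
  S.restrict_spec g l hl m hm.symm

/-- Any arrow with the defining property of the restriction `g|_l` is the restriction. -/
lemma arr_eq_restrict {x y : V} (g : x ⟶ y) (l : Λ.Path) (hl : Λ.r l = x) {a b : V}
    (ha : Λ.s l = a) (hb : Λ.s (S.act g l hl) = b) (h : a ⟶ b)
    (H : ∀ m (hm : Λ.r m = a),
      S.act g (Λ.comp l m (ha.trans hm.symm)) ((Λ.r_comp _ _ _).trans hl) =
        Λ.comp (S.act g l hl) (S.act h m hm) (hb.trans (S.r_act h m hm).symm)) :
    (⟨a, b, h⟩ : Arr V) = ⟨_, _, S.restrict g l hl⟩ := by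
  subst ha hb
  rw [S.restriction_unique g l hl H (S.restrict_spec g l hl)]

/-- The cocycle identity, obtained by letting both sides act on l m and using uniqueness of
restrictions. It is an equation in `Arr`, because the codomains s(g·(h·l)) and s((gh)·l) are equal
only by a theorem. -/
lemma restrict_comp {x y z : V} (h : x ⟶ y) (g : y ⟶ z) (l : Λ.Path) (hl : Λ.r l = x) :
    (⟨_, _, S.restrict h l hl ≫ S.restrict g (S.act h l hl) (S.r_act h l hl)⟩ : Arr V) =
      ⟨_, _, S.restrict (h ≫ g) l hl⟩ := by
  refine S.arr_eq_restrict (h ≫ g) l hl rfl (congrArg Λ.s (S.act_comp h g l hl)) _ fun m hm => ?_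
  rw [S.act_comp h g, S.act_congr g (S.act_comp_path h l hl m hm.symm _) _
    ((Λ.r_comp _ _ _).trans (S.r_act h l hl)), S.act_comp_path g _ (S.r_act h l hl)]
  exact comp_congr (S.act_comp h g l hl).symm (S.act_comp _ _ m hm).symm

lemma restrict_id {x : V} (l : Λ.Path) (hl : Λ.r l = x) :
    (⟨_, _, 𝟙 (Λ.s l)⟩ : Arr V) = ⟨_, _, S.restrict (𝟙 x) l hl⟩ := by
  refine S.arr_eq_restrict (𝟙 x) l hl rfl (congrArg Λ.s (S.act_id l hl)) _ fun m hm => ?_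
  rw [S.act_id]
  exact comp_congr (S.act_id l hl).symm (S.act_id m hm).symm

lemma restrict_inv {x y : V} (g : x ⟶ y) (l : Λ.Path) (hl : Λ.r l = x) :
    (⟨_, _, Groupoid.inv (S.restrict g l hl)⟩ : Arr V) =
      ⟨_, _, S.restrict (Groupoid.inv g) (S.act g l hl) (S.r_act g l hl)⟩ := by
  refine S.arr_eq_restrict _ _ _ rfl (congrArg Λ.s (S.act_inv_act g l hl)) _ fun m hm => ?_
  -- The path m' is chosen so that (g·l) m = g·(l m'), and g⁻¹ can then be applied.
  set m' := S.act (Groupoid.inv (S.restrict g l hl)) m hm with hm'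
  have hr : Λ.r m' = Λ.s l := S.r_act _ m hm
  have e : Λ.comp (S.act g l hl) m hm.symm =
      S.act g (Λ.comp l m' hr.symm) ((Λ.r_comp _ _ _).trans hl) := by
    rw [S.act_comp_path g l hl m' hr.symm]
    exact comp_congr rfl (S.act_act_inv _ m hm).symm
  rw [S.act_congr _ e _ (S.r_act _ _ _), S.act_inv_act]
  exact comp_congr (S.act_inv_act g l hl).symm rfl

/-- Letting g act on (lm)n = l(mn) and expanding twice shows that (g|_l)|_m has the property that
characterises g|_{lm}. -/
lemma restrict_comp_path {x y : V} (g : x ⟶ y) (l : Λ.Path) (hl : Λ.r l = x) (m : Λ.Path)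
    (hm : Λ.s l = Λ.r m) (h : Λ.r (Λ.comp l m hm) = x) :
    (⟨_, _, S.restrict (S.restrict g l hl) m hm.symm⟩ : Arr V) =
      ⟨_, _, S.restrict g (Λ.comp l m hm) h⟩ := by
  refine S.arr_eq_restrict g (Λ.comp l m hm) h (Λ.s_comp _ _ _) ?_ _ fun n hn => ?_
  · rw [S.act_comp_path g l hl m hm, Λ.s_comp]
  · rw [S.act_congr g (Λ.assoc l m n hm hn.symm) _ ((Λ.r_comp _ _ _).trans hl),
      S.act_comp_path g l hl]
    exact (comp_congr rfl (S.act_comp_path _ m hm.symm n hn.symm _)).trans <|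
      (Λ.assoc _ _ _ (S.r_act _ _ _).symm (S.r_act _ _ _).symm).symm.trans <|
        comp_congr (S.act_comp_path g l hl m hm h).symm rfl

lemma act_vertex {x y : V} (g : x ⟶ y) (l : Λ.Path) (hd : Λ.d l = 0) (hl : Λ.r l = x) :
    S.act g l hl = Λ.id y := by
  rw [eq_id_of_d_eq_zero ((S.d_act g l hl).trans hd), S.r_act]

/-- Restriction to a vertex changes nothing, which is why the left action on M_0 turns out to be
left multiplication on C*(G). -/
lemma restrict_vertex {x y : V} (g : x ⟶ y) (l : Λ.Path) (hd : Λ.d l = 0) (hl : Λ.r l = x) :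
    (⟨x, y, g⟩ : Arr V) = ⟨_, _, S.restrict g l hl⟩ := by
  have e1 : l = Λ.id x := by rw [eq_id_of_d_eq_zero hd, hl]
  have e2 := S.act_vertex g l hd hl
  refine S.arr_eq_restrict g l hl (by rw [e1, Λ.s_id]) (by rw [e2, Λ.s_id]) g fun m hm => ?_
  exact (S.act_congr g (id_comp' e1 _) _ hm).trans (id_comp' e2 _).symm

/-! ### The action on the path space of `Λ_p` -/

variable {p : Fin k → ℕ}

/-- The action of an arrow on the paths of `Λ_p` with range in its domain. -/
def actPath : ∀ (a : Arr V) (l : List (Λ.graph p).Edge), (Λ.graph p).IsPath a.dom l →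
    List (Λ.graph p).Edge
  | _, [], _ => []
  | a, e :: l, h => S.actDeg a.hom e h.1 ::
      actPath ⟨Λ.s e.1, Λ.s (S.act a.hom e.1 h.1), S.restrict a.hom e.1 h.1⟩ l h.2

lemma isPath_actPath (l : List (Λ.graph p).Edge) : ∀ (a : Arr V) (h : (Λ.graph p).IsPath a.dom l),
    (Λ.graph p).IsPath a.cod (S.actPath a l h) := by
  induction l with
  | nil => exact fun a _ => trivial
  | cons e l ih => exact fun a h => ⟨S.r_act a.hom e.1 h.1, ih ⟨_, _, S.restrict a.hom e.1 h.1⟩ h.2⟩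

lemma actPath_congr {a b : Arr V} (hab : a = b) {l m : List (Λ.graph p).Edge} (hlm : l = m)
    (h : (Λ.graph p).IsPath a.dom l) (h' : (Λ.graph p).IsPath b.dom m) :
    S.actPath a l h = S.actPath b m h' := by
  subst hab hlm
  rfl

lemma length_actPath (l : List (Λ.graph p).Edge) : ∀ (a : Arr V)
    (h : (Λ.graph p).IsPath a.dom l), (S.actPath a l h).length = l.length := by
  induction l with
  | nil => exact fun a _ => rfl
  | cons e l ih => exact fun a h => congrArg (· + 1) (ih _ h.2)

/-- The arrows vary in the induction: the tail is acted on by restrictions, and `restrict_comp`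
turns the restriction of a composite into a composite of restrictions. -/
lemma actPath_comp (l : List (Λ.graph p).Edge) : ∀ {x y z : V} (h : x ⟶ y) (g : y ⟶ z)
    (hl : (Λ.graph p).IsPath x l), S.actPath ⟨x, z, h ≫ g⟩ l hl =
      S.actPath ⟨y, z, g⟩ (S.actPath ⟨x, y, h⟩ l hl) (S.isPath_actPath l ⟨x, y, h⟩ hl) := by
  induction l with
  | nil => exact fun _ _ _ => rfl
  | cons e l ih =>
    intro x y z h g hl
    refine congrArg₂ List.cons (Subtype.ext (S.act_comp h g e.1 hl.1)) ?_
    exact (S.actPath_congr (S.restrict_comp h g e.1 hl.1).symm rfl _ _).trans (ih _ _ hl.2)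

lemma actPath_id (l : List (Λ.graph p).Edge) : ∀ {x : V} (hl : (Λ.graph p).IsPath x l),
    S.actPath ⟨x, x, 𝟙 x⟩ l hl = l := by
  induction l with
  | nil => exact fun _ => rfl
  | cons e l ih =>
    intro x hl
    refine congrArg₂ List.cons (Subtype.ext (S.act_id e.1 hl.1)) ?_
    exact (S.actPath_congr (S.restrict_id e.1 hl.1).symm rfl _ _).trans (ih hl.2)

lemma actPath_append (l : List (Λ.graph p).Edge) (e : (Λ.graph p).Edge) : ∀ (a : Arr V)
    (h : (Λ.graph p).IsPath a.dom (l ++ [e])) (h' : (Λ.graph p).IsPath a.dom l),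
    ∃ e', S.actPath a (l ++ [e]) h = S.actPath a l h' ++ [e'] := by
  induction l with
  | nil => exact fun a h h' => ⟨_, rfl⟩
  | cons f l ih =>
    intro a h h'
    obtain ⟨e', he'⟩ := ih ⟨_, _, S.restrict a.hom f.1 h.1⟩ h.2 h'.2
    exact ⟨e', congrArg (List.cons _) he'⟩

variable (p) in
/-- The action of `G` on the path space of `Λ_p` induced by its action on `Λ`. -/
def pathAction : (Λ.graph p).Action where
  φ {x y} g :=
    { toEquiv :=
      { toFun := fun l => ⟨S.actPath ⟨x, y, g⟩ l.1 l.2, S.isPath_actPath l.1 ⟨x, y, g⟩ l.2⟩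
        invFun := fun l => ⟨S.actPath ⟨y, x, Groupoid.inv g⟩ l.1 l.2,
          S.isPath_actPath l.1 ⟨y, x, Groupoid.inv g⟩ l.2⟩
        left_inv := fun l => Subtype.ext <| by
          refine (S.actPath_comp l.1 g (Groupoid.inv g) l.2).symm.trans ?_
          exact (S.actPath_congr (by rw [Groupoid.comp_inv]) rfl _ _).trans (S.actPath_id l.1 l.2)
        right_inv := fun l => Subtype.ext <| by
          refine (S.actPath_comp l.1 (Groupoid.inv g) g l.2).symm.trans ?_
          exact (S.actPath_congr (by rw [Groupoid.inv_comp]) rfl _ _).trans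
            (S.actPath_id l.1 l.2) }
      length_eq := fun l => S.length_actPath l.1 ⟨x, y, g⟩ l.2
      initial := fun l e h => S.actPath_append l.1 e ⟨x, y, g⟩ h l.2 }
  comp h g l := Subtype.ext (S.actPath_comp l.1 h g l.2)

lemma isInducedAction_pathAction : S.IsInducedAction p (S.pathAction p) :=
  fun _ _ _ _ => rfl

lemma isSelfSimilar_pathAction : (S.pathAction p).IsSelfSimilar :=
  fun g e he => ⟨S.actDeg g e he, S.restrict g e.1 he, fun _ => rfl⟩

end SelfSimilarAction

end KGraph

section

/-! ### Maps out of balanced tensor products -/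

section Tensor

open TensorProduct

variable {C A X Y Z : Type*} [CStarAlgebra C] [CStarAlgebra A] [PartialOrder A] [StarOrderedRing A]
  [AddCommGroup X] [Module ℂ X] [Module Cᵐᵒᵖ X]
  [NormedAddCommGroup Y] [NormedSpace ℂ Y] [Module Aᵐᵒᵖ Y] [HilbertModule A Y]
  {φ : LeftAction C A Y}

namespace AlgTensor

section

variable [AddCommGroup Z] [Module ℂ Z]

/-- The linear map on `X ⊙_C Y` given by a balanced bilinear map. -/
def lift (B : X →ₗ[ℂ] Y →ₗ[ℂ] Z) (hB : ∀ x c y, B (op c • x) y = B x (φ.toHom c y)) :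
    AlgTensor X φ →ₗ[ℂ] Z :=
  (balancingSubspace X φ).liftQ (TensorProduct.lift B) <| Submodule.span_le.mpr <| by
    rintro _ ⟨x, c, y, rfl⟩
    rw [SetLike.mem_coe, LinearMap.mem_ker, map_sub, TensorProduct.lift.tmul,
      TensorProduct.lift.tmul, hB, sub_self]

lemma lift_tmul (B : X →ₗ[ℂ] Y →ₗ[ℂ] Z) (hB : ∀ x c y, B (op c • x) y = B x (φ.toHom c y))
    (x : X) (y : Y) : lift B hB (tmul φ x y) = B x y := rfl

end

lemma induction_tmul {P : AlgTensor X φ → Prop} (h0 : P 0)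
    (hadd : ∀ t t', P t → P t' → P (t + t')) (h : ∀ x y, P (tmul φ x y)) (t : AlgTensor X φ) :
    P t := by
  obtain ⟨t, rfl⟩ := Submodule.mkQ_surjective _ t
  induction t with
  | zero => rw [map_zero]; exact h0
  | add t t' ht ht' => rw [map_add]; exact hadd _ _ ht ht'
  | tmul x y => exact h x y

lemma tmul_op_smul (x : X) (c : C) (y : Y) : tmul φ (op c • x) y = tmul φ x (φ.toHom c y) :=
  (Submodule.Quotient.eq _).mpr (Submodule.subset_span ⟨x, c, y, rfl⟩)

end AlgTensor

variable [PartialOrder C] [StarOrderedRing C] [InnerModule C X]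
  [NormedAddCommGroup Z] [NormedSpace ℂ Z] [Module Aᵐᵒᵖ Z] [HilbertModule A Z]

/-- Both inner products are biadditive, so elementary tensors decide. Surjectivity before completion
is stronger than dense range, and is available for the fibres. -/
lemma isTensorIso_of_tmul {π : AlgTensor X φ →ₗ[ℂ] Z}
    (hip : ∀ x x' y y', ip (π (AlgTensor.tmul φ x y)) (π (AlgTensor.tmul φ x' y')) =
      ip (A := A) y (φ.toHom (ip x x') y'))
    (hr : ∀ (x : X) (y : Y) (a : A),
      π (AlgTensor.tmul φ x (op a • y)) = op a • π (AlgTensor.tmul φ x y))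
    (hs : Function.Surjective π) : IsTensorIso φ π where
  ip_eq t t' := by
    induction t using AlgTensor.induction_tmul with
    | h0 => simp [ip_zero_left]
    | hadd t₁ t₂ h₁ h₂ => simp [ip_add_left, h₁, h₂]
    | h x y =>
      induction t' using AlgTensor.induction_tmul with
      | h0 => simp [ip_zero_right]
      | hadd t₁ t₂ h₁ h₂ => simp [ip_add_right, h₁, h₂]
      | h x' y' => rw [hip, AlgTensor.form_tmul]
  right := hr
  dense := hs.denseRange

end Tensor

/-! ### The standard basis of the fibres -/

namespace CornerSum

variable {A : Type*} [CStarAlgebra A] {ι : Type*} {P : ι → A} (hP : ∀ j, P j * P j = P j)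

open Classical in
lemma coord_single_self (j : ι) (a : A) : coord (single hP j a) j = P j * a :=
  Pi.single_eq_same (M := fun _ : ι => A) j _

open Classical in
lemma coord_single_of_ne {j n : ι} (h : n ≠ j) (a : A) : coord (single hP j a) n = 0 :=
  Pi.single_eq_of_ne (M := fun _ : ι => A) h _

end CornerSum

variable {V : Type u} [Groupoid.{v} V] [Fintype V]

lemma GroupoidCStar.i_congr {a b : Arr V} (h : a = b) :
    GroupoidCStar.i a.hom = GroupoidCStar.i b.hom := by rw [h]

namespace KGraph

open GroupoidCStar

variable {k : ℕ} {Λ : KGraph.{u, w} k V} {p : Fin k → ℕ}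

lemma coord_δ_self (l : Λ.Deg p) (a : GroupoidCStar V) :
    CornerSum.coord (Λ.δ l a) l = i (𝟙 (Λ.s l.1)) * a := CornerSum.coord_single_self _ l a

lemma coord_δ_of_ne {l n : Λ.Deg p} (h : n ≠ l) (a : GroupoidCStar V) :
    CornerSum.coord (Λ.δ l a) n = 0 := CornerSum.coord_single_of_ne _ h a

lemma i_mul_coord (m : Λ.Fibre p) (l : Λ.Deg p) :
    i (𝟙 (Λ.s l.1)) * CornerSum.coord m l = CornerSum.coord m l := CornerSum.coord_mem m l

lemma δ_add (l : Λ.Deg p) (a b : GroupoidCStar V) : Λ.δ l (a + b) = Λ.δ l a + Λ.δ l b := by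
  ext n
  rw [CornerSum.coord_add]
  rcases eq_or_ne n l with rfl | h
  · simp only [coord_δ_self, mul_add]
  · simp only [coord_δ_of_ne h, add_zero]

lemma δ_smul (l : Λ.Deg p) (c : ℂ) (a : GroupoidCStar V) : Λ.δ l (c • a) = c • Λ.δ l a := by
  ext n
  rw [CornerSum.coord_smul]
  rcases eq_or_ne n l with rfl | h
  · simp only [coord_δ_self, mul_smul_comm]
  · simp only [coord_δ_of_ne h, smul_zero]

lemma δ_zero (l : Λ.Deg p) : Λ.δ l 0 = 0 := by
  have h := δ_smul l 0 0
  rwa [zero_smul, zero_smul] at h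

lemma op_smul_δ (l : Λ.Deg p) (a b : GroupoidCStar V) : op b • Λ.δ l a = Λ.δ l (a * b) := by
  ext n
  rw [CornerSum.coord_op_smul, unop_op]
  rcases eq_or_ne n l with rfl | h
  · simp only [coord_δ_self, mul_assoc]
  · simp only [coord_δ_of_ne h, zero_mul]

lemma δ_eq_op_smul (l : Λ.Deg p) (a : GroupoidCStar V) : Λ.δ l a = op a • Λ.δ l 1 := by
  rw [op_smul_δ, one_mul]

/-- The projection onto the corner is built into `δ`; this allows 1 and i_{s(l)} to be exchanged as
coefficients. -/
lemma δ_i_id_mul (l : Λ.Deg p) (a : GroupoidCStar V) : Λ.δ l (i (𝟙 (Λ.s l.1)) * a) = Λ.δ l a := by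
  ext n
  rcases eq_or_ne n l with rfl | h
  · rw [coord_δ_self, coord_δ_self, ← mul_assoc, i_id_mul_i_id]
  · rw [coord_δ_of_ne h, coord_δ_of_ne h]

variable [∀ p, Fintype (Λ.Deg p)]

/-- Here finiteness of Λ^p enters. The elements `δ l 1` form a finite frame, on which additive and
right-linear maps are determined. -/
lemma sum_δ (m : Λ.Fibre p) : ∑ l, Λ.δ l (CornerSum.coord m l) = m := by
  classical
  have hc (n : Λ.Deg p) (s : Finset (Λ.Deg p)) (f : Λ.Deg p → Λ.Fibre p) :
      CornerSum.coord (∑ l ∈ s, f l) n = ∑ l ∈ s, CornerSum.coord (f l) n :=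
    map_sum (⟨⟨fun m => CornerSum.coord m n, rfl⟩, fun _ _ => rfl⟩ :
      Λ.Fibre p →+ GroupoidCStar V) f s
  ext n
  rw [hc, Finset.sum_eq_single n]
  · rw [coord_δ_self, i_mul_coord]
  · intro l _ h
    exact coord_δ_of_ne h.symm _
  · simp

/-- For a = 1 this expresses a coordinate as an inner product, so coordinates are bounded and
rank-one operators can select them. -/
lemma ip_δ_left (l : Λ.Deg p) (a : GroupoidCStar V) (m : Λ.Fibre p) :
    ip (Λ.δ l a) m = star a * CornerSum.coord m l := by
  rw [CornerSum.ip_def, Finset.sum_eq_single l]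
  · rw [coord_δ_self, star_mul, star_i, Groupoid.inv_eq_inv, IsIso.inv_id, mul_assoc,
      i_mul_coord]
  · intro n _ h
    rw [coord_δ_of_ne h, star_zero, zero_mul]
  · simp

lemma linearMap_surjective_of_δ {W : Type*} [AddCommGroup W] [Module ℂ W] {f : W →ₗ[ℂ] Λ.Fibre p}
    (h : ∀ l a, ∃ t, f t = Λ.δ l a) : Function.Surjective f := fun m => by
  rw [← sum_δ m]
  exact Submodule.sum_mem (LinearMap.range f) fun l _ => h l _

lemma addMonoidHom_ext_δ {W : Type*} [AddCommMonoid W] {f g : Λ.Fibre p →+ W}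
    (h : ∀ l a, f (Λ.δ l a) = g (Λ.δ l a)) : f = g := by
  ext m
  rw [← sum_δ m, map_sum, map_sum]
  exact Finset.sum_congr rfl fun l _ => h l _

lemma clm_ext_δ {W : Type*} [AddCommMonoid W] [Module ℂ W] [TopologicalSpace W]
    {f g : Λ.Fibre p →L[ℂ] W} (h : ∀ l a, f (Λ.δ l a) = g (Λ.δ l a)) : f = g :=
  ContinuousLinearMap.ext fun m => DFunLike.congr_fun
    (addMonoidHom_ext_δ (f := (f : Λ.Fibre p →+ W)) (g := (g : Λ.Fibre p →+ W)) h) m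

/-- Right linear maps on `M_p` are finite sums of rank-one operators. -/
lemma sum_rankOne_δ (f : Λ.Fibre p →ₗ[ℂ] Λ.Fibre p)
    (hf : ∀ (a : GroupoidCStar V) m, f (op a • m) = op a • f m) (m : Λ.Fibre p) :
    (∑ l, rankOne (GroupoidCStar V) (f (Λ.δ l 1)) (Λ.δ l 1)) m = f m := by
  conv_rhs => rw [← sum_δ m, map_sum]
  rw [sum_apply]
  refine Finset.sum_congr rfl fun l _ => ?_
  rw [rankOne_apply, ip_δ_left, star_one, one_mul, ← hf, ← δ_eq_op_smul]

/-- The frame expansion writes T as a finite sum of rank-one operators, so no limit is needed. -/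
lemma mem_compactOperators_of_right_linear {T : Λ.Fibre p →L[ℂ] Λ.Fibre p}
    (hT : ∀ (a : GroupoidCStar V) m, T (op a • m) = op a • T m) :
    T ∈ compactOperators (GroupoidCStar V) (Λ.Fibre p) := by
  have h : T = ∑ l, rankOne (GroupoidCStar V) (T (Λ.δ l 1)) (Λ.δ l 1) :=
    ContinuousLinearMap.ext fun m => (sum_rankOne_δ (T : Λ.Fibre p →ₗ[ℂ] Λ.Fibre p) hT m).symm
  rw [h]
  exact Submodule.sum_mem _ fun l _ =>
    Submodule.le_topologicalClosure _ (Submodule.subset_span ⟨_, _, rfl⟩)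

lemma isAdjointable_of_right_linear {T : Λ.Fibre p →L[ℂ] Λ.Fibre p}
    (hT : ∀ (a : GroupoidCStar V) m, T (op a • m) = op a • T m) :
    IsAdjointable (GroupoidCStar V) T := by
  have h : T = ∑ l, rankOne (GroupoidCStar V) (T (Λ.δ l 1)) (Λ.δ l 1) :=
    ContinuousLinearMap.ext fun m => (sum_rankOne_δ (T : Λ.Fibre p →ₗ[ℂ] Λ.Fibre p) hT m).symm
  rw [h]
  exact ⟨_, IsAdjointPair.sum fun l _ => isAdjointPair_rankOne _ _⟩

/-! ### The fibres as tensor products -/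

lemma fibreIsTensorProduct (p : Fin k → ℕ) : Λ.FibreIsTensorProduct p := by
  classical
  let _ : Fintype (Λ.graph p).Edge := inferInstanceAs (Fintype (Λ.Deg p))
  let B : (Λ.graph p).GraphModule →ₗ[ℂ] GroupoidCStar V →ₗ[ℂ] Λ.Fibre p :=
    LinearMap.mk₂ ℂ (fun x a => ∑ l : Λ.Deg p, DiGraph.GraphModule.val x l • Λ.δ l a)
      (fun x x' a => by
        rw [← Finset.sum_add_distrib]
        exact Finset.sum_congr rfl fun l _ => add_smul _ _ _)
      (fun c x a => by
        rw [Finset.smul_sum]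
        exact Finset.sum_congr rfl fun l _ => mul_smul c (DiGraph.GraphModule.val x l) _)
      (fun x a b => by simp only [δ_add, smul_add, Finset.sum_add_distrib])
      (fun c x a => by simp only [δ_smul, Finset.smul_sum, smul_comm c])
  have hB (x : (Λ.graph p).GraphModule) (a : GroupoidCStar V) :
      B x a = ∑ l : Λ.Deg p, DiGraph.GraphModule.val x l • Λ.δ l a := rfl
  -- The projections i_v are mutually orthogonal, so in the corner at w a function acts by its value
  -- at w. This is what makes `B` balanced.
  have hi (w : V) (f : V → ℂ) (a : GroupoidCStar V) :
      i (𝟙 w) * (vertexHom f * a) = f w • (i (𝟙 w) * a) := by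
    rw [vertexHom, ← mul_assoc, Finset.mul_sum, Finset.sum_eq_single w]
    · rw [mul_smul_comm, i_id_mul_i_id, smul_mul_assoc]
    · intro v _ hv
      rw [mul_smul_comm, i_mul_i_of_ne _ _ hv, smul_zero]
    · simp
  have hbal (x : (Λ.graph p).GraphModule) (f : V → ℂ) (a : GroupoidCStar V) :
      B (op f • x) a = B x ((vertexAction (V := V)).toHom f a) := by
    rw [hB, hB]
    refine Finset.sum_congr rfl fun l _ => ?_
    change (DiGraph.GraphModule.val x l * f (Λ.s l.1)) • _ = _ • Λ.δ l (vertexHom f * a)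
    rw [← δ_i_id_mul l (vertexHom f * a), hi, δ_smul, δ_i_id_mul, mul_smul]
  refine ⟨AlgTensor.lift B hbal, fun x a => rfl, isTensorIso_of_tmul (fun x x' a a' => ?_)
    (fun x a b => ?_) (linearMap_surjective_of_δ fun l a => ?_)⟩
  · rw [AlgTensor.lift_tmul, AlgTensor.lift_tmul, hB, ip_sum_left]
    -- The coordinate is found by pairing with `δ l 1`.
    have hc (l : Λ.Deg p) : CornerSum.coord (B x' a') l =
        DiGraph.GraphModule.val x' l • (i (𝟙 (Λ.s l.1)) * a') := by
      have h := ip_δ_left l 1 (B x' a')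
      rw [star_one, one_mul] at h
      rw [← h, hB, ip_sum_right, Finset.sum_eq_single l]
      · rw [ip_smul_right, ip_δ_left, star_one, one_mul, coord_δ_self]
      · intro n _ hn
        rw [ip_smul_right, ip_δ_left, coord_δ_of_ne hn.symm, mul_zero, smul_zero]
      · simp
    simp only [ip_smul_left, ip_δ_left, hc]
    change _ = star a * (vertexHom (ip x x') * a')
    rw [vertexHom, Finset.sum_mul, Finset.mul_sum]
    have hv (v : V) : star a * ((ip x x' : V → ℂ) v • i (𝟙 v) * a') =
        ∑ l : Λ.Deg p with Λ.s l.1 = v, (star (DiGraph.GraphModule.val x l) *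
          DiGraph.GraphModule.val x' l) • (star a * (i (𝟙 v) * a')) := by
      rw [← Finset.sum_smul, smul_mul_assoc, mul_smul_comm]
      congr 1
    simp only [hv]
    -- Paths are grouped by their source, since the inner product of X(Λ_p) at v sums over the paths
    -- with source v.
    rw [← Finset.sum_fiberwise_of_maps_to (s := Finset.univ) (t := Finset.univ)
      (g := fun l : Λ.Deg p => Λ.s l.1) (fun _ _ => Finset.mem_univ _)]
    refine Finset.sum_congr rfl fun v _ => Finset.sum_congr rfl fun l hl => ?_
    obtain rfl := (Finset.mem_filter.mp hl).2
    rw [mul_smul_comm, smul_smul]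
  · rw [AlgTensor.lift_tmul, AlgTensor.lift_tmul]
    ext n
    rw [hB, hB, Finset.smul_sum]
    congr 1
    refine Finset.sum_congr rfl fun l _ => ?_
    ext n
    rw [CornerSum.coord_smul, CornerSum.coord_op_smul, CornerSum.coord_smul, smul_mul_assoc,
      ← CornerSum.coord_op_smul, op_smul_δ]
    rfl
  -- The tensor of the point mass at l with a is a preimage of δ_l ⊗ a.
  · let x : (Λ.graph p).GraphModule := (Pi.single l 1 : Λ.Deg p → ℂ)
    have hx : DiGraph.GraphModule.val x l = 1 :=
      Pi.single_eq_same (M := fun _ : Λ.Deg p => ℂ) l 1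
    have hx' (n : Λ.Deg p) (hn : n ≠ l) : DiGraph.GraphModule.val x n = 0 :=
      Pi.single_eq_of_ne (M := fun _ : Λ.Deg p => ℂ) hn 1
    refine ⟨AlgTensor.tmul _ x a, ?_⟩
    rw [AlgTensor.lift_tmul, hB, Finset.sum_eq_single l]
    · rw [hx, one_smul]
    · intro n _ hn
      rw [hx' n hn, zero_smul]
    · simp

end KGraph

end

section

/-! ### Factorisation of paths -/

namespace KGraph

section Factorisation

variable {k : ℕ} {V : Type u} {Λ : KGraph.{u, w} k V} {p q r : Fin k → ℕ} (h : p + q = r)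

/-- The composite of composable paths of degrees `p` and `q`. -/
def compDeg (l : Λ.Deg p) (m : Λ.Deg q) (hlm : Λ.s l.1 = Λ.r m.1) : Λ.Deg r :=
  ⟨Λ.comp l.1 m.1 hlm, by rw [Λ.d_comp, l.2, m.2, h]⟩

lemma exists_compDeg_eq (n : Λ.Deg r) :
    ∃ (m : Λ.Deg p × Λ.Deg q) (hm : Λ.s m.1.1 = Λ.r m.2.1), compDeg h m.1 m.2 hm = n := by
  obtain ⟨⟨l, m⟩, ⟨hl, hm, hlm, e⟩, -⟩ := Λ.factorisation n.1 p q (n.2.trans h.symm)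
  exact ⟨(⟨l, hl⟩, ⟨m, hm⟩), hlm, Subtype.ext e⟩

/-- The initial segment of degree `p` of a path of degree `p + q`. -/
def fstDeg (n : Λ.Deg r) : Λ.Deg p := (exists_compDeg_eq h n).choose.1

/-- The final segment of degree `q` of a path of degree `p + q`. -/
def sndDeg (n : Λ.Deg r) : Λ.Deg q := (exists_compDeg_eq h n).choose.2

lemma s_fstDeg (n : Λ.Deg r) : Λ.s (fstDeg h n).1 = Λ.r (sndDeg h n).1 :=
  (exists_compDeg_eq h n).choose_spec.choose

lemma compDeg_fstDeg_sndDeg (n : Λ.Deg r) :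
    compDeg h (fstDeg h n) (sndDeg h n) (s_fstDeg h n) = n :=
  (exists_compDeg_eq h n).choose_spec.choose_spec

lemma compDeg_inj {l l' : Λ.Deg p} {m m' : Λ.Deg q} {hlm : Λ.s l.1 = Λ.r m.1}
    {hlm' : Λ.s l'.1 = Λ.r m'.1} (e : compDeg h l m hlm = compDeg h l' m' hlm') :
    l = l' ∧ m = m' := by
  obtain ⟨n, -, hn⟩ := Λ.factorisation (compDeg h l m hlm).1 p q
    ((compDeg h l m hlm).2.trans h.symm)
  have h1 := hn (l.1, m.1) ⟨l.2, m.2, hlm, rfl⟩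
  have h2 := hn (l'.1, m'.1) ⟨l'.2, m'.2, hlm', congrArg Subtype.val e.symm⟩
  exact ⟨Subtype.ext (congrArg Prod.fst (h1.trans h2.symm)),
    Subtype.ext (congrArg Prod.snd (h1.trans h2.symm))⟩

lemma fstDeg_compDeg (l : Λ.Deg p) (m : Λ.Deg q) (hlm : Λ.s l.1 = Λ.r m.1) :
    fstDeg h (compDeg h l m hlm) = l := (compDeg_inj h (compDeg_fstDeg_sndDeg h _)).1

lemma sndDeg_compDeg (l : Λ.Deg p) (m : Λ.Deg q) (hlm : Λ.s l.1 = Λ.r m.1) :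
    sndDeg h (compDeg h l m hlm) = m := (compDeg_inj h (compDeg_fstDeg_sndDeg h _)).2

lemma s_sndDeg (n : Λ.Deg r) : Λ.s (sndDeg h n).1 = Λ.s n.1 := by
  conv_rhs => rw [← compDeg_fstDeg_sndDeg h n]
  exact (Λ.s_comp _ _ _).symm

/-- Regrouping the three pieces from one bracketing factors n according to the other, and
factorisations are unique. This is the combinatorial content of associativity. -/
lemma fstDeg_sndDeg_assoc {s pq qr : Fin k → ℕ} {t : Fin k → ℕ} (h₁ : p + q = pq)
    (h₂ : q + s = qr) (h₃ : pq + s = t) (h₄ : p + qr = t) (n : Λ.Deg t) :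
    fstDeg h₁ (fstDeg h₃ n) = fstDeg h₄ n ∧
      sndDeg h₁ (fstDeg h₃ n) = fstDeg h₂ (sndDeg h₄ n) ∧
      sndDeg h₃ n = sndDeg h₂ (sndDeg h₄ n) := by
  have e1 : Λ.s (sndDeg h₁ (fstDeg h₃ n)).1 = Λ.r (sndDeg h₃ n).1 :=
    (s_sndDeg h₁ _).trans (s_fstDeg h₃ n)
  have e2 : Λ.s (fstDeg h₁ (fstDeg h₃ n)).1 =
      Λ.r (compDeg h₂ (sndDeg h₁ (fstDeg h₃ n)) (sndDeg h₃ n) e1).1 :=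
    (s_fstDeg h₁ _).trans (Λ.r_comp _ _ _).symm
  have e : compDeg h₄ (fstDeg h₁ (fstDeg h₃ n))
      (compDeg h₂ (sndDeg h₁ (fstDeg h₃ n)) (sndDeg h₃ n) e1) e2 = n := by
    refine Subtype.ext ((Λ.assoc _ _ _ (s_fstDeg h₁ _) e1).symm.trans ?_)
    refine Eq.trans ?_ (congrArg Subtype.val (compDeg_fstDeg_sndDeg h₃ n))
    exact comp_congr (congrArg Subtype.val (compDeg_fstDeg_sndDeg h₁ (fstDeg h₃ n))) rfl
  have e3 := compDeg_inj h₄ (e.trans (compDeg_fstDeg_sndDeg h₄ n).symm)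
  refine ⟨e3.1, ?_⟩
  rw [← e3.2, fstDeg_compDeg, sndDeg_compDeg]
  exact ⟨rfl, rfl⟩

/-- A path of degree zero is an identity, so the summands of M_0 are indexed by vertices. -/
lemma eq_of_deg_zero {l l' : Λ.Deg 0} (h : Λ.s l.1 = Λ.s l'.1) : l = l' := by
  have h1 (l : Λ.Deg 0) : l.1 = Λ.id (Λ.s l.1) := by
    have e := eq_id_of_d_eq_zero l.2
    have e' := congrArg Λ.s e
    rw [Λ.s_id] at e'
    rw [e', ← e]
  exact Subtype.ext (by rw [h1 l, h1 l', h])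

lemma sndDeg_zero_add (n : Λ.Deg p) : sndDeg (zero_add p) n = n := by
  have e : compDeg (zero_add p) (SelfSimilarAction.vertex Λ (Λ.r n.1)) n (Λ.s_id _) = n :=
    Subtype.ext (Λ.id_comp n.1)
  conv_lhs => rw [← e]
  exact sndDeg_compDeg _ _ _ _

lemma fstDeg_add_zero (n : Λ.Deg p) : fstDeg (add_zero p) n = n := by
  have e : compDeg (add_zero p) n (SelfSimilarAction.vertex Λ (Λ.s n.1)) (Λ.r_id _).symm = n :=
    Subtype.ext (Λ.comp_id n.1)
  conv_lhs => rw [← e]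
  exact fstDeg_compDeg _ _ _ _

/-- Factorisation identifies paths of degree r with the composable pairs, and `hF` kills the
remaining pairs. -/
lemma sum_fstDeg_sndDeg [∀ p, Fintype (Λ.Deg p)] {W : Type*} [AddCommMonoid W]
    (F : Λ.Deg p → Λ.Deg q → W) (hF : ∀ l m, Λ.s l.1 ≠ Λ.r m.1 → F l m = 0) :
    ∑ n : Λ.Deg r, F (fstDeg h n) (sndDeg h n) = ∑ l, ∑ m, F l m := by
  rw [← Fintype.sum_prod_type']
  refine Fintype.sum_of_injective (fun n => (fstDeg h n, sndDeg h n)) (fun n n' e => ?_) _ _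
    (fun lm hlm => hF _ _ fun e => hlm ⟨compDeg h lm.1 lm.2 e, ?_⟩) fun n => rfl
  · obtain ⟨e1, e2⟩ := Prod.mk.inj e
    rw [← compDeg_fstDeg_sndDeg h n, ← compDeg_fstDeg_sndDeg h n']
    exact Subtype.ext (comp_congr (congrArg Subtype.val e1) (congrArg Subtype.val e2))
  · exact Prod.ext (fstDeg_compDeg h _ _ e) (sndDeg_compDeg h _ _ e)

end Factorisation

end KGraph

/-! ### The left action on the fibres -/

variable {V : Type u} [Groupoid.{v} V]

section Induction

variable [Fintype V]

lemma GroupoidCStar.induction_i {P : GroupoidCStar V → Prop} (hc : IsClosed {a | P a}) (h0 : P 0)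
    (hadd : ∀ a b, P a → P b → P (a + b)) (hsmul : ∀ (z : ℂ) a, P a → P (z • a))
    (hi : ∀ {x y : V} (g : x ⟶ y), P (i g)) (a : GroupoidCStar V) : P a := by
  induction a using induction with
  | hc => exact hc
  | h f =>
    induction f using GroupoidAlgebra.induction_pt with
    | hadd f g hf hg => rw [of_add]; exact hadd _ _ hf hg
    | hsmul z f hf => rw [of_smul]; exact hsmul _ _ hf
    | hpt a => exact hi a.hom
    | hzero => exact h0

lemma GroupoidCStar.i_id_congr {x y : V} (h : x = y) :
    (i (𝟙 x) : GroupoidCStar V) = i (𝟙 y) := by rw [h]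

end Induction

namespace KGraph

open GroupoidCStar

variable {k : ℕ} {Λ : KGraph.{u, w} k V}

namespace SelfSimilarAction

section ActDeg

variable (S : Λ.SelfSimilarAction) {p : Fin k → ℕ}

lemma actDeg_inv_actDeg {x y : V} (g : x ⟶ y) (l : Λ.Deg p) (hl : Λ.r l.1 = x) :
    S.actDeg (Groupoid.inv g) (S.actDeg g l hl) (S.r_act g l.1 hl) = l :=
  Subtype.ext (S.act_inv_act g l.1 hl)

lemma actDeg_actDeg_inv {x y : V} (g : x ⟶ y) (l : Λ.Deg p) (hl : Λ.r l.1 = y) :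
    S.actDeg g (S.actDeg (Groupoid.inv g) l hl) (S.r_act _ l.1 hl) = l :=
  Subtype.ext (S.act_act_inv g l.1 hl)

end ActDeg

variable [Fintype V] [∀ p, Fintype (Λ.Deg p)] (S : Λ.SelfSimilarAction) {p : Fin k → ℕ}

open Classical in
variable (p) in
/-- The operator on `M_p` with `δ_l ⊗ b ↦ δ_{g · l} ⊗ i_{g|_l} b` if `r(l) = dom(g)`, and
`δ_l ⊗ b ↦ 0` otherwise. -/
def opArr (a : Arr V) : Λ.Fibre p →L[ℂ] Λ.Fibre p :=
  -- As a sum of rank-one operators the map is bounded by construction.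
  ∑ l : Λ.Deg p, if hl : Λ.r l.1 = a.dom then
    rankOne (GroupoidCStar V) (Λ.δ (S.actDeg a.hom l hl) (i (S.restrict a.hom l.1 hl))) (Λ.δ l 1)
  else 0

lemma opArr_δ {x y : V} (g : x ⟶ y) (l : Λ.Deg p) (hl : Λ.r l.1 = x) (b : GroupoidCStar V) :
    S.opArr p ⟨x, y, g⟩ (Λ.δ l b) = Λ.δ (S.actDeg g l hl) (i (S.restrict g l.1 hl) * b) := by
  rw [opArr, sum_apply, Finset.sum_eq_single l]
  · rw [dif_pos hl, rankOne_apply, ip_δ_left, star_one, one_mul, coord_δ_self, op_smul_δ,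
      ← mul_assoc, i_mul_i, Category.id_comp]
  · intro n _ hn
    split_ifs
    · rw [rankOne_apply, ip_δ_left, coord_δ_of_ne hn, mul_zero, op_zero, zero_smul]
    · rfl
  · simp

lemma opArr_δ_of_ne {a : Arr V} {l : Λ.Deg p} (hl : Λ.r l.1 ≠ a.dom) (b : GroupoidCStar V) :
    S.opArr p a (Λ.δ l b) = 0 := by
  rw [opArr, sum_apply]
  refine Finset.sum_eq_zero fun n _ => ?_
  split_ifs with hn
  · rw [rankOne_apply, ip_δ_left, coord_δ_of_ne, mul_zero, op_zero, zero_smul]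
    rintro rfl
    exact hl hn
  · rfl

lemma isAdjointPair_of_δ {T T' : Λ.Fibre p →L[ℂ] Λ.Fibre p}
    (h : ∀ l a n b, ip (T (Λ.δ l a)) (Λ.δ n b) =
      ip (A := GroupoidCStar V) (Λ.δ l a) (T' (Λ.δ n b))) :
    IsAdjointPair (GroupoidCStar V) T T' := by
  intro x y
  rw [← sum_δ x, ← sum_δ y]
  simp only [map_sum, ip_sum_left, ip_sum_right, h]

/-- Multiplicativity is `restrict_comp`. The adjoint relation combines `restrict_inv` with the fact
that g⁻¹ undoes the action of g on paths: the matrix of g has its only entry in column l at row g·l.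
-/
lemma isRep_opArr : GroupoidAlgebra.IsRep (GroupoidCStar V) (S.opArr p) where
  mul {x y z} g h := by
    refine clm_ext_δ fun l b => ?_
    rw [mul_apply_eq_comp]
    by_cases hl : Λ.r l.1 = x
    · rw [S.opArr_δ h l hl, S.opArr_δ g _ (S.r_act h l.1 hl), S.opArr_δ _ l hl, ← mul_assoc]
      congr 1
      · exact Subtype.ext (S.act_comp h g l.1 hl).symm
      · congr 1
        exact (i_mul_i _ _).trans (i_congr (S.restrict_comp h g l.1 hl))
    · rw [S.opArr_δ_of_ne (by exact hl), S.opArr_δ_of_ne (by exact hl), map_zero]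
  mul_of_ne {a b} hne := by
    refine clm_ext_δ fun l c => ?_
    rw [mul_apply_eq_comp, zero_apply]
    by_cases hl : Λ.r l.1 = b.dom
    · rw [S.opArr_δ b.hom l hl]
      exact S.opArr_δ_of_ne (fun e => hne ((S.r_act b.hom l.1 hl).symm.trans e)) _
    · rw [S.opArr_δ_of_ne hl, map_zero]
  adjoint := by
    rintro ⟨x, y, g⟩
    refine isAdjointPair_of_δ fun l a n b => ?_
    change _ = ip _ (S.opArr p ⟨y, x, Groupoid.inv g⟩ _)
    by_cases hl : Λ.r l.1 = x
    · rw [S.opArr_δ g l hl, ip_δ_left, ip_δ_left]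
      by_cases hn : n = S.actDeg g l hl
      · subst hn
        have e1 : i (S.restrict (Groupoid.inv g) (S.actDeg g l hl).1 (S.r_act g l.1 hl)) =
            star (i (S.restrict g l.1 hl)) :=
          (i_congr (S.restrict_inv g l.1 hl)).symm.trans (star_i _).symm
        rw [S.opArr_δ (Groupoid.inv g) _ (S.r_act g l.1 hl), coord_δ_self, e1,
          S.actDeg_inv_actDeg g l hl, coord_δ_self, star_mul, star_i, mul_assoc]
        simp only [← mul_assoc]
        congr 1
        rw [mul_assoc, mul_assoc]
        congr 1
        exact (i_mul_i _ _).trans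
          (((congrArg i (Category.id_comp _)).trans (congrArg i (Category.comp_id _).symm)).trans
            (i_mul_i _ _).symm)
      -- If n ≠ g·l then g⁻¹·n ≠ l, so both matrix entries vanish.
      · rw [coord_δ_of_ne (fun e => hn e.symm), mul_zero]
        by_cases hr : Λ.r n.1 = y
        · rw [S.opArr_δ _ n hr, coord_δ_of_ne, mul_zero]
          rintro rfl
          exact hn (S.actDeg_actDeg_inv g n hr).symm
        · rw [S.opArr_δ_of_ne (by exact hr), CornerSum.coord_zero, mul_zero]
    · rw [S.opArr_δ_of_ne (by exact hl), ip_zero_left, ip_δ_left]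
      by_cases hr : Λ.r n.1 = y
      · rw [S.opArr_δ _ n hr, coord_δ_of_ne, mul_zero]
        rintro rfl
        exact hl (S.r_act _ n.1 hr)
      · rw [S.opArr_δ_of_ne (by exact hr), CornerSum.coord_zero, mul_zero]

variable (p) in
/-- The left action of `C*(G)` on `M_p`. -/
def leftAct : LeftAction (GroupoidCStar V) (GroupoidCStar V) (Λ.Fibre p) :=
  leftActionOfRep (S.isRep_opArr (p := p))

lemma leftAct_i {x y : V} (g : x ⟶ y) : (S.leftAct p).toHom (i g) = S.opArr p ⟨x, y, g⟩ :=
  leftActionOfRep_i _ g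

lemma leftAct_i_δ {x y : V} (g : x ⟶ y) (l : Λ.Deg p) (hl : Λ.r l.1 = x) (b : GroupoidCStar V) :
    (S.leftAct p).toHom (i g) (Λ.δ l b) =
      Λ.δ (S.actDeg g l hl) (i (S.restrict g l.1 hl) * b) := by
  rw [leftAct_i, S.opArr_δ g l hl]

lemma leftAct_i_δ_of_ne {x y : V} (g : x ⟶ y) {l : Λ.Deg p} (hl : Λ.r l.1 ≠ x)
    (b : GroupoidCStar V) : (S.leftAct p).toHom (i g) (Λ.δ l b) = 0 := by
  rw [leftAct_i, S.opArr_δ_of_ne (by exact hl)]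

lemma leftAct_id_δ (l : Λ.Deg p) (b : GroupoidCStar V) :
    (S.leftAct p).toHom (i (𝟙 (Λ.r l.1))) (Λ.δ l b) = Λ.δ l b := by
  rw [S.leftAct_i_δ _ l rfl, ← δ_i_id_mul l b]
  congr 1
  · exact Subtype.ext (S.act_id l.1 rfl)
  · congr 1
    exact (i_congr (S.restrict_id l.1 rfl)).symm

/-- In 1 = ∑ i_v only the term v = r(l) acts on δ_l ⊗ b without annihilating it. -/
lemma leftAct_one (x : Λ.Fibre p) : (S.leftAct p).toHom 1 x = x := by
  rw [← sum_δ x, map_sum]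
  refine Finset.sum_congr rfl fun l _ => ?_
  rw [← sum_i_id, map_sum, sum_apply, Finset.sum_eq_single (Λ.r l.1)]
  · exact S.leftAct_id_δ l _
  · intro v _ hv
    exact S.leftAct_i_δ_of_ne _ hv.symm _
  · simp

/-! ### Coordinates of the left action. -/

variable (Λ) in
/-- The coordinate at `l` as a linear functional on `M_p`. -/
def coordL (l : Λ.Deg p) : Λ.Fibre p →L[ℂ] GroupoidCStar V :=
  LinearMap.mkContinuous
    { toFun := fun m => CornerSum.coord m l
      map_add' := fun _ _ => rfl
      map_smul' := fun _ _ => rfl } ‖Λ.δ l 1‖ fun m => by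
    have h := norm_ip_le (A := GroupoidCStar V) (Λ.δ l 1) m
    rwa [ip_δ_left, star_one, one_mul] at h

lemma coord_sum {ι : Type*} (s : Finset ι) (f : ι → Λ.Fibre p) (n : Λ.Deg p) :
    CornerSum.coord (∑ j ∈ s, f j) n = ∑ j ∈ s, CornerSum.coord (f j) n :=
  map_sum (coordL Λ n) f s

/-- Density arguments over C*(G) are made one coordinate at a time, so continuity of the
multiplication of the fibres is never needed. -/
lemma continuous_coord_leftAct (y : Λ.Fibre p) (n : Λ.Deg p) :
    Continuous fun a => CornerSum.coord ((S.leftAct p).toHom a y) n :=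
  ((coordL Λ n).continuous.comp (ContinuousLinearMap.apply ℂ _ y).continuous).comp
    (S.leftAct p).continuous

lemma coord_leftAct_id (w : Λ.Fibre p) (n : Λ.Deg p) :
    CornerSum.coord ((S.leftAct p).toHom (i (𝟙 (Λ.r n.1))) w) n = CornerSum.coord w n := by
  rw [← sum_δ w, map_sum, coord_sum, coord_sum]
  refine Finset.sum_congr rfl fun l _ => ?_
  by_cases hl : Λ.r l.1 = Λ.r n.1
  · rw [← i_id_congr hl, leftAct_id_δ]
  · rw [S.leftAct_i_δ_of_ne _ hl, coord_δ_of_ne, CornerSum.coord_zero]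
    rintro rfl
    exact hl rfl

/-- Acting by i_{r(n)} does not change the coordinate at n, but it annihilates i_g when r(n) ≠
cod(g). -/
lemma coord_leftAct_of_ne {x y : V} (g : x ⟶ y) (w : Λ.Fibre p) {n : Λ.Deg p}
    (hn : Λ.r n.1 ≠ y) : CornerSum.coord ((S.leftAct p).toHom (i g) w) n = 0 := by
  rw [← S.coord_leftAct_id, ← LeftAction.toHom_mul_apply, i_mul_i_of_ne _ _ hn.symm, map_zero,
    zero_apply, CornerSum.coord_zero]

/-- The coordinate x(l) lies in the corner of i_{s(l)}, so x(l)·y lives on paths that can follow l.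
This is the vanishing needed in `sum_fstDeg_sndDeg`. -/
lemma coord_leftAct_coord_of_ne {q : Fin k → ℕ} (x : Λ.Fibre p) (y : Λ.Fibre q) {l : Λ.Deg p}
    {m : Λ.Deg q} (h : Λ.s l.1 ≠ Λ.r m.1) :
    CornerSum.coord ((S.leftAct q).toHom (CornerSum.coord x l) y) m = 0 := by
  rw [← i_mul_coord x, LeftAction.toHom_mul_apply, S.coord_leftAct_of_ne _ _ h.symm]

end SelfSimilarAction

end KGraph

end

section

variable {V : Type u} [Groupoid.{v} V] [Fintype V]

namespace KGraph

open GroupoidCStar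

variable {k : ℕ} {Λ : KGraph.{u, w} k V}

/-! ### The multiplication -/

section Shift

variable {p q r : Fin k → ℕ} (h : p + q = r)

open Classical in
/-- The map `M_q → M_{p + q}` with `δ_m ⊗ b ↦ δ_{l m} ⊗ b`. -/
def shift (l : Λ.Deg p) : Λ.Fibre q →ₗ[ℂ] Λ.Fibre r where
  toFun y := ⟨fun n => if fstDeg h n = l then CornerSum.coord y (sndDeg h n) else 0, fun n => by
    dsimp only
    split_ifs
    · rw [i_id_congr (s_sndDeg h n).symm]
      exact CornerSum.coord_mem y _
    · exact mul_zero _⟩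
  map_add' y z := CornerSum.ext fun n => by
    change (if fstDeg h n = l then CornerSum.coord (y + z) (sndDeg h n) else 0) =
      (if fstDeg h n = l then CornerSum.coord y (sndDeg h n) else 0) +
        if fstDeg h n = l then CornerSum.coord z (sndDeg h n) else 0
    split_ifs
    · rfl
    · rw [add_zero]
  map_smul' c y := CornerSum.ext fun n => by
    change (if fstDeg h n = l then CornerSum.coord (c • y) (sndDeg h n) else 0) =
      c • if fstDeg h n = l then CornerSum.coord y (sndDeg h n) else 0
    split_ifs
    · rfl
    · rw [smul_zero]

lemma coord_shift {l : Λ.Deg p} {n : Λ.Deg r} (hn : fstDeg h n = l) (y : Λ.Fibre q) :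
    CornerSum.coord (shift h l y) n = CornerSum.coord y (sndDeg h n) := if_pos hn

lemma coord_shift_of_ne {l : Λ.Deg p} {n : Λ.Deg r} (hn : fstDeg h n ≠ l) (y : Λ.Fibre q) :
    CornerSum.coord (shift h l y) n = 0 := if_neg hn

open Classical in
/-- The map `M_{p + q} → M_q` with `δ_{l m} ⊗ b ↦ δ_m ⊗ b` that vanishes on `δ_n ⊗ b` if `n` does
not begin with `l`. -/
def coshift (l : Λ.Deg p) : Λ.Fibre r →ₗ[ℂ] Λ.Fibre q where
  toFun z := ⟨fun m => if hm : Λ.s l.1 = Λ.r m.1 then CornerSum.coord z (compDeg h l m hm) else 0,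
    fun m => by
      dsimp only
      split_ifs with hm
      · rw [i_id_congr (Λ.s_comp l.1 m.1 hm).symm]
        exact CornerSum.coord_mem z (compDeg h l m hm)
      · exact mul_zero _⟩
  map_add' y z := CornerSum.ext fun m => by
    change (if hm : Λ.s l.1 = Λ.r m.1 then CornerSum.coord (y + z) (compDeg h l m hm) else 0) =
      (if hm : Λ.s l.1 = Λ.r m.1 then CornerSum.coord y (compDeg h l m hm) else 0) +
        if hm : Λ.s l.1 = Λ.r m.1 then CornerSum.coord z (compDeg h l m hm) else 0
    split_ifs
    · rfl
    · rw [add_zero]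
  map_smul' c z := CornerSum.ext fun m => by
    change (if hm : Λ.s l.1 = Λ.r m.1 then CornerSum.coord (c • z) (compDeg h l m hm) else 0) =
      c • if hm : Λ.s l.1 = Λ.r m.1 then CornerSum.coord z (compDeg h l m hm) else 0
    split_ifs
    · rfl
    · rw [smul_zero]

lemma coord_coshift {l : Λ.Deg p} {m : Λ.Deg q} (hm : Λ.s l.1 = Λ.r m.1) (z : Λ.Fibre r) :
    CornerSum.coord (coshift h l z) m = CornerSum.coord z (compDeg h l m hm) := dif_pos hm

lemma coord_coshift_of_ne {l : Λ.Deg p} {m : Λ.Deg q} (hm : Λ.s l.1 ≠ Λ.r m.1) (z : Λ.Fibre r) :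
    CornerSum.coord (coshift h l z) m = 0 := dif_neg hm

lemma coshift_op_smul (l : Λ.Deg p) (a : GroupoidCStar V) (z : Λ.Fibre r) :
    coshift h l (op a • z) = op a • coshift h l z := by
  ext m
  rw [CornerSum.coord_op_smul]
  by_cases hm : Λ.s l.1 = Λ.r m.1
  · rw [coord_coshift h hm, coord_coshift h hm]
    rfl
  · rw [coord_coshift_of_ne h hm, coord_coshift_of_ne h hm, zero_mul]

lemma shift_δ (l : Λ.Deg p) (m : Λ.Deg q) (hm : Λ.s l.1 = Λ.r m.1) (b : GroupoidCStar V) :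
    shift h l (Λ.δ m b) = Λ.δ (compDeg h l m hm) b := by
  ext n
  by_cases hn : n = compDeg h l m hm
  · subst hn
    rw [coord_shift h (fstDeg_compDeg h l m hm), sndDeg_compDeg, coord_δ_self, coord_δ_self]
    congr 1
    exact i_id_congr (Λ.s_comp _ _ _).symm
  · rw [coord_δ_of_ne hn]
    by_cases hl : fstDeg h n = l
    · rw [coord_shift h hl, coord_δ_of_ne]
      rintro rfl
      subst hl
      exact hn (compDeg_fstDeg_sndDeg h n).symm
    · exact coord_shift_of_ne h hl _

lemma shift_δ_of_ne {l : Λ.Deg p} {m : Λ.Deg q} (hm : Λ.s l.1 ≠ Λ.r m.1) (b : GroupoidCStar V) :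
    shift h l (Λ.δ m b) = 0 := by
  ext n
  rw [CornerSum.coord_zero]
  by_cases hl : fstDeg h n = l
  · rw [coord_shift h hl, coord_δ_of_ne]
    rintro rfl
    subst hl
    exact hm (s_fstDeg h n)
  · exact coord_shift_of_ne h hl _

end Shift

namespace SelfSimilarAction

variable [∀ p, Fintype (Λ.Deg p)] (S : Λ.SelfSimilarAction) {p q r : Fin k → ℕ} (h : p + q = r)

/-- The operator form of g·(lm) = (g·l)(g|_l·m) together with g|_{lm} = (g|_l)|_m. -/
lemma leftAct_shift {x y : V} (g : x ⟶ y) (l : Λ.Deg p) (hl : Λ.r l.1 = x) (z : Λ.Fibre q) :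
    (S.leftAct r).toHom (i g) (shift h l z) =
      shift h (S.actDeg g l hl) ((S.leftAct q).toHom (i (S.restrict g l.1 hl)) z) := by
  rw [← sum_δ z]
  simp only [map_sum]
  refine Finset.sum_congr rfl fun m _ => ?_
  by_cases hm : Λ.s l.1 = Λ.r m.1
  · have hr : Λ.r (compDeg h l m hm).1 = x := (Λ.r_comp _ _ _).trans hl
    rw [shift_δ h l m hm, S.leftAct_i_δ g _ hr, S.leftAct_i_δ _ m hm.symm,
      shift_δ h _ _ (S.r_act _ m.1 hm.symm).symm]
    congr 1
    · exact Subtype.ext (S.act_comp_path g l.1 hl m.1 hm _)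
    · congr 1
      exact (i_congr (S.restrict_comp_path g l.1 hl m.1 hm hr)).symm
  · rw [shift_δ_of_ne h hm, S.leftAct_i_δ_of_ne _ (Ne.symm hm), map_zero, map_zero]

lemma leftAct_shift_of_ne {x y : V} (g : x ⟶ y) {l : Λ.Deg p} (hl : Λ.r l.1 ≠ x)
    (z : Λ.Fibre q) : (S.leftAct r).toHom (i g) (shift h l z) = 0 := by
  rw [← sum_δ z]
  simp only [map_sum]
  refine Finset.sum_eq_zero fun m _ => ?_
  by_cases hm : Λ.s l.1 = Λ.r m.1
  · rw [shift_δ h l m hm, S.leftAct_i_δ_of_ne]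
    exact fun e => hl ((Λ.r_comp _ _ _).symm.trans e)
  · rw [shift_δ_of_ne h hm, map_zero]

/-- Only coordinates at paths with range s(l) survive `shift`, and i_{s(l)} fixes those. -/
lemma shift_leftAct_id (l : Λ.Deg p) (z : Λ.Fibre q) :
    shift h l ((S.leftAct q).toHom (i (𝟙 (Λ.s l.1))) z) = shift h l z := by
  ext n
  by_cases hn : fstDeg h n = l
  · subst hn
    rw [coord_shift h rfl, coord_shift h rfl, i_id_congr (s_fstDeg h n), coord_leftAct_id]
  · rw [coord_shift_of_ne h hn, coord_shift_of_ne h hn]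

/-- The multiplication `M_p × M_q → M_{p + q}`. -/
def fibreMul : Λ.Fibre p →ₗ[ℂ] Λ.Fibre q →ₗ[ℂ] Λ.Fibre r :=
  LinearMap.mk₂ ℂ (fun x y => ∑ l, shift h l ((S.leftAct q).toHom (CornerSum.coord x l) y))
    (fun x x' y => by
      simp only [CornerSum.coord_add, map_add, add_apply, Finset.sum_add_distrib])
    (fun c x y => by
      simp only [CornerSum.coord_smul, map_smul, smul_apply, Finset.smul_sum])
    (fun x y y' => by simp only [map_add, Finset.sum_add_distrib])
    (fun c x y => by simp only [map_smul, Finset.smul_sum])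

/-- Since n has one initial segment of degree p, one term of the sum survives. Balancedness, right
linearity, associativity and isometry are read off from this formula. -/
lemma coord_fibreMul (x : Λ.Fibre p) (y : Λ.Fibre q) (n : Λ.Deg r) :
    CornerSum.coord (S.fibreMul h x y) n =
      CornerSum.coord ((S.leftAct q).toHom (CornerSum.coord x (fstDeg h n)) y) (sndDeg h n) := by
  rw [fibreMul, LinearMap.mk₂_apply, coord_sum, Finset.sum_eq_single (fstDeg h n)]
  · exact coord_shift h rfl _
  · exact fun l _ hl => coord_shift_of_ne h hl.symm _
  · simp

lemma fibreMul_δ (l : Λ.Deg p) (a : GroupoidCStar V) (y : Λ.Fibre q) :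
    S.fibreMul h (Λ.δ l a) y = shift h l ((S.leftAct q).toHom a y) := by
  rw [fibreMul, LinearMap.mk₂_apply, Finset.sum_eq_single l]
  · rw [coord_δ_self, LeftAction.toHom_mul_apply, shift_leftAct_id]
  · intro n _ hn
    rw [coord_δ_of_ne hn, map_zero, zero_apply, map_zero]
  · simp

lemma fibreMul_op_smul_left (c : GroupoidCStar V) (x : Λ.Fibre p) (y : Λ.Fibre q) :
    S.fibreMul h (op c • x) y = S.fibreMul h x ((S.leftAct q).toHom c y) := by
  ext n
  rw [coord_fibreMul, coord_fibreMul, CornerSum.coord_op_smul, unop_op,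
    LeftAction.toHom_mul_apply]

lemma fibreMul_op_smul_right (x : Λ.Fibre p) (y : Λ.Fibre q) (a : GroupoidCStar V) :
    S.fibreMul h x (op a • y) = op a • S.fibreMul h x y := by
  ext n
  rw [coord_fibreMul, LeftAction.map_op_smul, CornerSum.coord_op_smul, CornerSum.coord_op_smul,
    coord_fibreMul]

/-- By density and linearity the case a = i_g, x = δ_l ⊗ b suffices, and that is `leftAct_shift`. -/
lemma fibreMul_leftAct (a : GroupoidCStar V) (x : Λ.Fibre p) (y : Λ.Fibre q) :
    S.fibreMul h ((S.leftAct p).toHom a x) y = (S.leftAct r).toHom a (S.fibreMul h x y) := by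
  induction a using induction_i with
  | hc =>
    have e : {a | S.fibreMul h ((S.leftAct p).toHom a x) y =
        (S.leftAct r).toHom a (S.fibreMul h x y)} =
        ⋂ n, {a | CornerSum.coord (S.fibreMul h ((S.leftAct p).toHom a x) y) n =
          CornerSum.coord ((S.leftAct r).toHom a (S.fibreMul h x y)) n} := by
      ext a
      rw [Set.mem_iInter]
      exact CornerSum.ext_iff
    rw [e]
    refine isClosed_iInter fun n => isClosed_eq ?_ (S.continuous_coord_leftAct _ _)
    simp only [coord_fibreMul]
    exact (S.continuous_coord_leftAct _ _).comp (S.continuous_coord_leftAct _ _)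
  | h0 => simp
  | hadd a b ha hb => simp [ha, hb]
  | hsmul z a ha => simp [ha]
  | @hi v w g =>
    rw [← sum_δ x]
    simp only [map_sum, LinearMap.sum_apply]
    refine Finset.sum_congr rfl fun l _ => ?_
    by_cases hl : Λ.r l.1 = v
    · rw [S.leftAct_i_δ g l hl, fibreMul_δ, fibreMul_δ, S.leftAct_shift h g l hl,
        LeftAction.toHom_mul_apply]
    · rw [S.leftAct_i_δ_of_ne g hl, fibreMul_δ, S.leftAct_shift_of_ne h g hl, map_zero]
      rfl

/-- With n = n₁n₂n₃, both sides have coordinate ((x(n₁)·y)(n₂)·z)(n₃) at n; on the right this uses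
x(n₁)·(yz) = (x(n₁)·y)z. -/
lemma fibreMul_assoc {s pq qr t : Fin k → ℕ} (h₁ : p + q = pq) (h₂ : q + s = qr)
    (h₃ : pq + s = t) (h₄ : p + qr = t) (x : Λ.Fibre p) (y : Λ.Fibre q) (z : Λ.Fibre s) :
    S.fibreMul h₃ (S.fibreMul h₁ x y) z = S.fibreMul h₄ x (S.fibreMul h₂ y z) := by
  ext n
  obtain ⟨e1, e2, e3⟩ := fstDeg_sndDeg_assoc h₁ h₂ h₃ h₄ n
  rw [coord_fibreMul, coord_fibreMul, coord_fibreMul, ← fibreMul_leftAct, coord_fibreMul, e1, e2,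
    e3]

/-- After summing over pairs (l, m) instead of n, the sum over m is ⟨x(l)·y, x'(l)·y'⟩ = ⟨y,
x(l)*x'(l)·y'⟩, and summing over l forms ⟨x, x'⟩. -/
lemma ip_fibreMul (x x' : Λ.Fibre p) (y y' : Λ.Fibre q) :
    ip (A := GroupoidCStar V) (S.fibreMul h x y) (S.fibreMul h x' y') =
      ip y ((S.leftAct q).toHom (ip x x') y') := by
  rw [CornerSum.ip_def]
  simp only [coord_fibreMul]
  rw [sum_fstDeg_sndDeg h (fun l m =>
    star (CornerSum.coord ((S.leftAct q).toHom (CornerSum.coord x l) y) m) *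
      CornerSum.coord ((S.leftAct q).toHom (CornerSum.coord x' l) y') m)]
  · rw [CornerSum.ip_def x x', map_sum, sum_apply, ip_sum_right]
    refine Finset.sum_congr rfl fun l _ => ?_
    rw [← CornerSum.ip_def, (S.leftAct q).adjoint, ← LeftAction.toHom_mul_apply]
  · intro l m hlm
    rw [S.coord_leftAct_coord_of_ne x y hlm, star_zero, zero_mul]

lemma exists_fibreMul_eq_δ (n : Λ.Deg r) (a : GroupoidCStar V) :
    S.fibreMul h (Λ.δ (fstDeg h n) 1) (Λ.δ (sndDeg h n) a) = Λ.δ n a := by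
  rw [fibreMul_δ, leftAct_one, shift_δ h _ _ (s_fstDeg h n), compDeg_fstDeg_sndDeg]

/-! ### The unit -/

variable (Λ) in
/-- The identification of `C*(G)` with `M_0`. -/
def fibreUnit : GroupoidCStar V ≃ₗ[ℂ] Λ.Fibre 0 where
  toFun a := ⟨fun l => i (𝟙 (Λ.s l.1)) * a, fun l => by rw [← mul_assoc, i_id_mul_i_id]⟩
  map_add' a b := CornerSum.ext fun l => mul_add _ _ _
  map_smul' c a := CornerSum.ext fun l => mul_smul_comm _ _ _
  -- The projections i_v are orthogonal with sum 1 and Λ^0 corresponds to V, so an element of C*(G)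
  -- is the sum of its corner components.
  invFun m := ∑ l, CornerSum.coord m l
  left_inv a := by
    change ∑ l : Λ.Deg 0, i (𝟙 (Λ.s l.1)) * a = a
    rw [← Finset.sum_mul]
    conv_rhs => rw [← one_mul a, ← sum_i_id]
    congr 1
    refine Fintype.sum_bijective (fun l : Λ.Deg 0 => Λ.s l.1)
      ⟨fun l l' e => eq_of_deg_zero e, fun v => ⟨vertex Λ v, Λ.s_id v⟩⟩ _ _ fun l => rfl
  right_inv m := CornerSum.ext fun n => by
    change i (𝟙 (Λ.s n.1)) * ∑ l, CornerSum.coord m l = CornerSum.coord m n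
    rw [Finset.mul_sum, Finset.sum_eq_single n]
    · exact i_mul_coord m n
    · intro l _ hl
      rw [← i_mul_coord m l, ← mul_assoc, i_mul_i_of_ne _ _ fun e => hl (eq_of_deg_zero e),
        zero_mul]
    · simp

lemma coord_fibreUnit (a : GroupoidCStar V) (l : Λ.Deg 0) :
    CornerSum.coord (fibreUnit Λ a) l = i (𝟙 (Λ.s l.1)) * a := rfl

lemma fibreUnit_eq_sum (a : GroupoidCStar V) : fibreUnit Λ a = ∑ l, Λ.δ l a := by
  rw [← sum_δ (fibreUnit Λ a)]
  exact Finset.sum_congr rfl fun l _ => δ_i_id_mul l a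

lemma fibreUnit_i_mul {x y : V} (g : x ⟶ y) (a : GroupoidCStar V) :
    fibreUnit Λ (i g * a) = Λ.δ (vertex Λ y) (i g * a) := by
  rw [fibreUnit_eq_sum, Finset.sum_eq_single (vertex Λ y)]
  · intro l _ hl
    rw [← δ_i_id_mul, ← mul_assoc, i_mul_i_of_ne, zero_mul, δ_zero]
    intro e
    exact hl (eq_of_deg_zero (e.symm.trans (Λ.s_id y).symm))
  · simp

/-- On generators only the component at dom(g) is moved, to the vertex cod(g), and its coefficient
is multiplied by g|_{dom(g)} = g. -/
lemma fibreUnit_mul (a b : GroupoidCStar V) :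
    fibreUnit Λ (a * b) = (S.leftAct 0).toHom a (fibreUnit Λ b) := by
  induction a using induction_i with
  | hc =>
    have e : {a | fibreUnit Λ (a * b) = (S.leftAct 0).toHom a (fibreUnit Λ b)} =
        ⋂ n, {a | CornerSum.coord (fibreUnit Λ (a * b)) n =
          CornerSum.coord ((S.leftAct 0).toHom a (fibreUnit Λ b)) n} := by
      ext a
      rw [Set.mem_iInter]
      exact CornerSum.ext_iff
    rw [e]
    refine isClosed_iInter fun n => isClosed_eq ?_ (S.continuous_coord_leftAct _ _)
    simp only [coord_fibreUnit]
    fun_prop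
  | h0 => simp
  | hadd a a' ha ha' => simp [add_mul, ha, ha']
  | hsmul z a ha => simp [ha]
  | @hi x y g =>
    rw [fibreUnit_i_mul, fibreUnit_eq_sum, map_sum, Finset.sum_eq_single (vertex Λ x)]
    · rw [S.leftAct_i_δ g (vertex Λ x) (Λ.r_id x)]
      congr 1
      · exact Subtype.ext (S.act_vertex g (Λ.id x) (Λ.d_id x) (Λ.r_id x)).symm
      · congr 1
        exact i_congr (S.restrict_vertex g (Λ.id x) (Λ.d_id x) (Λ.r_id x))
    · intro l _ hl
      refine S.leftAct_i_δ_of_ne g (fun e => hl (eq_of_deg_zero ?_)) b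
      have e1 := congrArg Λ.s (eq_id_of_d_eq_zero l.2)
      rw [Λ.s_id, e] at e1
      exact e1.trans (Λ.s_id x).symm
    · simp

/-! ### The product system -/

/-- The product system of a self-similar groupoid action. -/
def productSystem : ProductSystem (GroupoidCStar V) fun p => Λ.Fibre p where
  left := S.leftAct
  unit := fibreUnit Λ
  unit_ip a b := by
    rw [fibreUnit_eq_sum, ip_sum_left]
    simp only [ip_δ_left]
    rw [← Finset.mul_sum]
    congr 1
    -- Summing the coordinates is by definition the inverse of `fibreUnit`.
    exact (fibreUnit Λ).symm_apply_apply b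
  unit_right a b := CornerSum.ext fun l => by
    rw [CornerSum.coord_op_smul, coord_fibreUnit, coord_fibreUnit, mul_assoc, unop_op]
  unit_left := S.fibreUnit_mul
  mul h := S.fibreMul h
  mul_assoc h₁ h₂ h₃ h₄ := S.fibreMul_assoc h₁ h₂ h₃ h₄
  mul_iso {p q r} h :=
    ⟨AlgTensor.lift (S.fibreMul h) fun x c y => S.fibreMul_op_smul_left h c x y, fun x y => rfl,
      isTensorIso_of_tmul (fun x x' y y' => S.ip_fibreMul h x x' y y')
        (fun x y a => S.fibreMul_op_smul_right h x y a)
        (linearMap_surjective_of_δ fun l a =>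
          ⟨AlgTensor.tmul _ _ _, S.exists_fibreMul_eq_δ h l a⟩),
      fun a x y => S.fibreMul_leftAct h a x y⟩
  -- The degree-(0, p) factorisation of n is r(n) followed by n, so only i_{r(n)} a acts at this
  -- coordinate, and i_{r(n)} is invisible there.
  unit_mul {p} a x := CornerSum.ext fun n => by
    rw [coord_fibreMul, coord_fibreUnit, LeftAction.toHom_mul_apply,
      i_id_congr (s_fstDeg (zero_add p) n), coord_leftAct_id, sndDeg_zero_add]
  mul_unit {p} a x := CornerSum.ext fun n => by
    rw [coord_fibreMul, ← fibreUnit_mul, coord_fibreUnit, s_sndDeg, fstDeg_add_zero, ← mul_assoc,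
      i_mul_coord]
    rfl

/-- The construction treats degree zero like every other degree, so the formula needs no case
distinction. -/
lemma mulFormula_productSystem (p q : Fin k → ℕ) : S.MulFormula S.productSystem p q := by
  intro r hr l m x y g g'
  change S.fibreMul hr (Λ.δ l (i g)) (Λ.δ m (i g')) = _
  rw [fibreMul_δ]
  split_ifs with hm
  · rw [S.leftAct_i_δ g m hm, shift_δ hr l _ (S.r_act g m.1 hm).symm]
    congr 1
    exact i_mul_i _ _
  · rw [S.leftAct_i_δ_of_ne g hm, map_zero]

lemma isCanonical_productSystem : S.IsCanonical S.productSystem where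
  left p l a x y g := by
    change (S.leftAct p).toHom (i g) (Λ.δ l a) = _
    split_ifs with hl
    · exact S.leftAct_i_δ g l hl a
    · exact S.leftAct_i_δ_of_ne g hl a
  unit {x y} g := by
    have h := fibreUnit_i_mul (Λ := Λ) g 1
    rwa [mul_one] at h
  mul p q _ _ := S.mulFormula_productSystem p q

/-! ### Uniqueness -/

variable {S}

lemma IsCanonical.left_eq {M : ProductSystem (GroupoidCStar V) fun p => Λ.Fibre p}
    (hM : S.IsCanonical M) : M.left = S.leftAct := by
  funext p
  refine leftAction_ext fun g => clm_ext_δ fun l a => ?_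
  rw [hM.left p l a g]
  exact (S.isCanonical_productSystem.left p l a g).symm

/-- Balancedness is not an axiom of `ProductSystem`; it holds because the multiplication factors
through the balanced tensor product. -/
lemma mul_op_smul_left (M : ProductSystem (GroupoidCStar V) fun p => Λ.Fibre p)
    (a : GroupoidCStar V) (x : Λ.Fibre p) (y : Λ.Fibre q) :
    M.mul h (op a • x) y = M.mul h x ((M.left q).toHom a y) := by
  obtain ⟨π, hπ, -⟩ := M.mul_iso h
  rw [← hπ, ← hπ, AlgTensor.tmul_op_smul]

lemma mul_op_smul_right (M : ProductSystem (GroupoidCStar V) fun p => Λ.Fibre p)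
    (x : Λ.Fibre p) (a : GroupoidCStar V) (y : Λ.Fibre q) :
    M.mul h x (op a • y) = op a • M.mul h x y := by
  obtain ⟨π, hπ, hiso, -⟩ := M.mul_iso h
  rw [← hπ, ← hπ, hiso.right]

/-- The right coefficient of the first factor can be moved onto the second as a left action, and
that of the second can be pulled out of the product. Only products of the elements `δ l 1` remain.
-/
lemma mul_ext {M N : ProductSystem (GroupoidCStar V) fun p => Λ.Fibre p}
    (hleft : M.left = N.left) (hMN : ∀ (l : Λ.Deg p) (m : Λ.Deg q),
      M.mul h (Λ.δ l 1) (Λ.δ m 1) = N.mul h (Λ.δ l 1) (Λ.δ m 1)) : M.mul h = N.mul h := by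
  have h1 (l : Λ.Deg p) (y : Λ.Fibre q) : M.mul h (Λ.δ l 1) y = N.mul h (Λ.δ l 1) y := by
    rw [← sum_δ y, map_sum, map_sum]
    refine Finset.sum_congr rfl fun m _ => ?_
    rw [δ_eq_op_smul m, mul_op_smul_right, mul_op_smul_right, hMN]
  ext1 x
  ext1 y
  rw [← sum_δ x, map_sum, map_sum, LinearMap.sum_apply, LinearMap.sum_apply]
  refine Finset.sum_congr rfl fun l _ => ?_
  rw [δ_eq_op_smul l, mul_op_smul_left, mul_op_smul_left, h1, hleft]

lemma IsCanonical.unique {M : ProductSystem (GroupoidCStar V) fun p => Λ.Fibre p}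
    (hM : S.IsCanonical M) : M = S.productSystem := by
  have hN := S.isCanonical_productSystem
  have hleft : M.left = S.productSystem.left := hM.left_eq
  have hunit : M.unit = S.productSystem.unit := by
    -- Right linearity determines the unit map by its value at 1 = ∑ i_v, where the prescribed
    -- values apply.
    have h1 : M.unit 1 = S.productSystem.unit 1 := by
      rw [← sum_i_id, map_sum, map_sum]
      exact Finset.sum_congr rfl fun v _ => (hM.unit _).trans (hN.unit _).symm
    ext1 a
    rw [← one_mul a, M.unit_right, S.productSystem.unit_right, h1]
  -- The multiplication formula speaks only of coefficients i_g.
  have hδ {p : Fin k → ℕ} (l : Λ.Deg p) : Λ.δ l 1 = Λ.δ l (i (𝟙 (Λ.s l.1))) := by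
    rw [← δ_i_id_mul l 1, mul_one]
  refine ProductSystem.ext hleft hunit ?_
  funext p q r h
  -- In degree zero the formula is not assumed; since the unit map is onto M_0, the unit axioms
  -- reduce these products to the left and right actions.
  by_cases hp : p = 0
  · subst hp
    obtain rfl : q = r := (zero_add q).symm.trans h
    ext1 x
    obtain ⟨a, rfl⟩ := M.unit.surjective x
    ext1 y
    rw [M.unit_mul, hunit, S.productSystem.unit_mul, hleft]
  by_cases hq : q = 0
  · subst hq
    obtain rfl : p = r := (add_zero p).symm.trans h
    ext1 x
    ext1 y
    obtain ⟨a, rfl⟩ := M.unit.surjective y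
    rw [M.mul_unit, hunit, S.productSystem.mul_unit]
  refine mul_ext h hleft fun l m => ?_
  rw [hδ l, hδ m, hM.mul p q hp hq r h, hN.mul p q hp hq r h]

/-! ### Compactness -/

variable (S)

lemma isEssential_productSystem : S.productSystem.IsEssential := fun _ x => S.leftAct_one x

lemma actsByCompacts_productSystem : S.productSystem.ActsByCompacts := fun p a =>
  mem_compactOperators_of_right_linear fun b m => (S.leftAct p).map_op_smul a b m

lemma map_op_smul_of_mem_compactOperators {T : Λ.Fibre p →L[ℂ] Λ.Fibre p}
    (hT : T ∈ compactOperators (GroupoidCStar V) (Λ.Fibre p)) (a : GroupoidCStar V)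
    (m : Λ.Fibre p) : T (op a • m) = op a • T m := by
  -- Right linearity at the given `a` and `m`, stated coordinatewise so that closedness follows from
  -- continuity of the coordinates. It holds for rank-one operators, hence for limits of their
  -- combinations.
  let K : Submodule ℂ (Λ.Fibre p →L[ℂ] Λ.Fibre p) :=
    { carrier := {T | ∀ l, CornerSum.coord (T (op a • m)) l = CornerSum.coord (T m) l * a}
      add_mem' := fun hT hT' l => by
        rw [add_apply, add_apply, CornerSum.coord_add, CornerSum.coord_add, hT, hT', add_mul]
      zero_mem' := fun l => (zero_mul _).symm
      smul_mem' := fun c T hT l => by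
        rw [smul_apply, smul_apply, CornerSum.coord_smul, CornerSum.coord_smul, hT,
          smul_mul_assoc] }
  have hK : IsClosed (K : Set (Λ.Fibre p →L[ℂ] Λ.Fibre p)) := by
    have e : (K : Set (Λ.Fibre p →L[ℂ] Λ.Fibre p)) = ⋂ l, {T : Λ.Fibre p →L[ℂ] Λ.Fibre p |
        coordL Λ l (T (op a • m)) = coordL Λ l (T m) * a} := by
      ext T
      rw [Set.mem_iInter]
      rfl
    rw [e]
    refine isClosed_iInter fun l => isClosed_eq ?_ (Continuous.mul ?_ continuous_const)
    · exact (coordL Λ l).continuous.comp (ContinuousLinearMap.apply ℂ _ (op a • m)).continuous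
    · exact (coordL Λ l).continuous.comp (ContinuousLinearMap.apply ℂ _ m).continuous
  have hle : compactOperators (GroupoidCStar V) (Λ.Fibre p) ≤ K := by
    refine Submodule.topologicalClosure_minimal _ (Submodule.span_le.mpr ?_) hK
    rintro _ ⟨x, y, rfl⟩ l
    rw [(isAdjointPair_rankOne x y).map_op_smul]
    rfl
  exact CornerSum.ext fun l => hle hT l

/-- Here `coshift` recovers x(l)·y from xy, and T(x)y = ∑ T(δ_l ⊗ 1)(x(l)·y). This gives the induced
operator explicitly, without inverting the tensor product isomorphism. -/
lemma sum_fibreMul_coshift (T : Λ.Fibre p →L[ℂ] Λ.Fibre p)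
    (hT : ∀ (a : GroupoidCStar V) m, T (op a • m) = op a • T m) (x : Λ.Fibre p) (y : Λ.Fibre q) :
    ∑ l, S.fibreMul h (T (Λ.δ l 1)) (coshift h l (S.fibreMul h x y)) = S.fibreMul h (T x) y := by
  have h1 (l : Λ.Deg p) : coshift h l (S.fibreMul h x y) =
      (S.leftAct q).toHom (CornerSum.coord x l) y := by
    ext m
    by_cases hm : Λ.s l.1 = Λ.r m.1
    · rw [coord_coshift h hm, coord_fibreMul, fstDeg_compDeg, sndDeg_compDeg]
    · rw [coord_coshift_of_ne h hm, S.coord_leftAct_coord_of_ne x y hm]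
  conv_rhs => rw [← sum_δ x, map_sum, map_sum, LinearMap.sum_apply]
  refine Finset.sum_congr rfl fun l _ => ?_
  rw [h1, ← fibreMul_op_smul_left, ← hT, ← δ_eq_op_smul]

lemma exists_isAmplification (h : p + q = r) (T : Λ.Fibre p →L[ℂ] Λ.Fibre p)
    (hT : ∀ (a : GroupoidCStar V) m, T (op a • m) = op a • T m) :
    ∃ T' : Λ.Fibre r →L[ℂ] Λ.Fibre r, (∀ (a : GroupoidCStar V) m, T' (op a • m) = op a • T' m) ∧
      S.productSystem.IsAmplification T T' := by
  let f : Λ.Fibre r →ₗ[ℂ] Λ.Fibre r := ∑ l, S.fibreMul h (T (Λ.δ l 1)) ∘ₗ coshift h l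
  have hf (z : Λ.Fibre r) : f z = ∑ l, S.fibreMul h (T (Λ.δ l 1)) (coshift h l z) := by
    simp [f]
  have hf' (a : GroupoidCStar V) (z : Λ.Fibre r) : f (op a • z) = op a • f z := by
    simp only [hf, coshift_op_smul, fibreMul_op_smul_right, Finset.smul_sum]
  -- The map `f` is only known to be linear; its expansion into rank-one operators provides a
  -- bounded operator with the same values.
  have hT' := sum_rankOne_δ f hf'
  have hlin (a : GroupoidCStar V) (m : Λ.Fibre r) :
      (∑ l, rankOne (GroupoidCStar V) (f (Λ.δ l 1)) (Λ.δ l 1)) (op a • m) =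
      op a • (∑ l, rankOne (GroupoidCStar V) (f (Λ.δ l 1)) (Λ.δ l 1)) m := by
    rw [hT', hT', hf']
  refine ⟨_, hlin, isAdjointable_of_right_linear hlin, fun q' h' x y => ?_⟩
  -- `IsAmplification` quantifies over every complement of p in r, and cancellation in ℕ^k leaves
  -- only one.
  obtain rfl : q = q' := add_left_cancel (h.trans h'.symm)
  rw [hT', hf]
  exact S.sum_fibreMul_coshift h T hT x y

/-- The induced operators are right linear, hence so is their composite, and right-linear operators
on a fibre are compact. -/
lemma isCompactlyAligned_productSystem : S.productSystem.IsCompactlyAligned := by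
  intro p q T hT T' hT'
  obtain ⟨U, hU, hTU⟩ := S.exists_isAmplification (add_tsub_cancel_of_le (le_sup_left (b := q))) T
    (map_op_smul_of_mem_compactOperators hT)
  obtain ⟨U', hU', hTU'⟩ := S.exists_isAmplification
    (add_tsub_cancel_of_le (le_sup_right (a := p))) T' (map_op_smul_of_mem_compactOperators hT')
  refine ⟨U, U', hTU, hTU', mem_compactOperators_of_right_linear fun a m => ?_⟩
  rw [ContinuousLinearMap.comp_apply, hU', hU]
  rfl

end SelfSimilarAction

end KGraph

end

end SSGA

end

theorem mainTheorem6 {k : ℕ} {V : Type*} [Fintype V] [CategoryTheory.Groupoid V]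
    (Λ : SSGA.KGraph k V) [∀ p, Fintype (Λ.Deg p)] (S : Λ.SelfSimilarAction) :
    (∀ p : Fin k → ℕ, p ≠ 0 →
      ∃ ψ : (Λ.graph p).Action, ψ.IsSelfSimilar ∧ S.IsInducedAction p ψ) ∧
    (∀ p, Λ.FibreIsTensorProduct p) ∧
    (∃! M : SSGA.ProductSystem (SSGA.GroupoidCStar V) fun p => Λ.Fibre p, S.IsCanonical M) ∧
    (∀ M : SSGA.ProductSystem (SSGA.GroupoidCStar V) fun p => Λ.Fibre p, S.IsCanonical M →
      (∀ p q, S.MulFormula M p q) ∧ M.IsEssential ∧ M.ActsByCompacts ∧ M.IsCompactlyAligned) := by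
  refine ⟨fun p _ => ⟨S.pathAction p, S.isSelfSimilar_pathAction, S.isInducedAction_pathAction⟩,
    SSGA.KGraph.fibreIsTensorProduct,
    ⟨S.productSystem, S.isCanonical_productSystem, fun M hM => hM.unique⟩, fun M hM => ?_⟩
  -- Uniqueness reduces the claims about an arbitrary canonical system to the constructed one.
  rw [hM.unique]
  exact ⟨S.mulFormula_productSystem, S.isEssential_productSystem, S.actsByCompacts_productSystem,
    S.isCompactlyAligned_productSystem⟩
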